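/- Let $\mathcal H=\mathcal H_1\otimes\cdots\otimes\mathcal H_n$ be a tensor product of nonzero finite-dimensional complex Hilbert spaces ("particles"), let $G=(V,E)$ be a simple graph on $V=\{1,\dots,n\}$, and for each edge $(j,k)\in E$, $j<k$, let $\Pi_{jk}$ be an orthogonal projector on $\mathcal H$ of the form $\Pi_{jk}=h[j,k]$ (an operator $h$ on $\mathcal H_j\otimes\mathcal H_k$ tensored with the identity on the other particles). Assume that all the $\Pi_{jk}$ commute pairwise, and put $\mathcal L=\{\psi\in\mathcal H:\Pi_{jk}\psi=\psi\text{ for all }(j,k)\in E\}$. (1) There exist orthogonal direct sum decompositions $\mathcal H_j=\bigoplus_{\alpha_j}\mathcal H_j^{(\alpha_j)}$, $1\le j\le n$, and tensor product structures $$\mathcal H_j^{(\alpha_j)}=\mathcal H_{j.j}^{(\alpha_j)}\otimes\bigotimes_{k:(j,k)\in E}\mathcal H_{j.k}^{(\alpha_j)}$$ with nonzero Hilbert spaces $\mathcal H_{j.j}^{(\alpha_j)}$, $\mathcal H_{j.k}^{(\alpha_j)}$, and operators $h_{jk}^{(\alpha_j\alpha_k)}$ on $\mathcal H_{j.k}^{(\alpha_j)}\otimes\mathcal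 H_{k.j}^{(\alpha_k)}$ for each edge $(j,k)$, such that every $\Pi_{jk}$ preserves each subspace $\mathcal H^{(\alpha)}=\mathcal H_1^{(\alpha_1)}\otimes\cdots\otimes\mathcal H_n^{(\alpha_n)}$, $\alpha=(\alpha_1,\dots,\alpha_n)$, and acts on it as $h_{jk}^{(\alpha_j\alpha_k)}$ on the two factors $\mathcal H_{j.k}^{(\alpha_j)}\otimes\mathcal H_{k.j}^{(\alpha_k)}$ and as the identity on all the other factors $\mathcal H_{l.l}^{(\alpha_l)}$, $\mathcal H_{l.m}^{(\alpha_l)}$. Moreover, for the same decompositions, $$\mathcal L=\bigoplus_\alpha\mathcal L\cap\mathcal H^{(\alpha)},\qquad \mathcal L\cap\mathcal H^{(\alpha)}=\Big(\bigotimes_{j=1}^n\mathcal H_{j.j}^{(\alpha_j)}\Big)\otimes\Big(\bigotimes_{(j,k)\in E}\mathcal M_{jk}^{(\alpha_j\alpha_k)}\Big),$$ where the sum is orthogonal and $\mathcal M_{jk}^{(\alpha_j\alpha_k)}=\{\phi\in\mathcal H_{j.k}^{(\alpha_j)}\otimes\mathcal H_{k.j}^{(\alpha_k)}:h_{jk}^{(\alpha_j\alpha_k)}\phi=\phi\}$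 (some of these spaces may be zero). (2) Suppose that the family is irreducible: for every $j$, the only operators $O$ on $\mathcal H_j$ such that $O[j]$ ($O$ tensored with the identity on the other particles) commutes with all the projectors of the family are the scalars. Then there are decompositions as in (1) in which every $\mathcal H_j$ has a single block and all the free factors $\mathcal H_{j.j}$ are one-dimensional. That is, $\mathcal H_j=\bigotimes_{k:(j,k)\in E}\mathcal H_{j.k}$, each $\Pi_{jk}$ acts only on $\mathcal H_{j.k}\otimes\mathcal H_{k.j}$, and $\mathcal L=\bigotimes_{(j,k)\in E}\mathcal M_{jk}$. If in addition $\Pi_{jk}\ne0$ for all $(j,k)\in E$, then $\mathcal L\ne0$. -/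

import Mathlib

noncomputable section

namespace CES

/-- The Hilbert space `⨂_p ℂ^{κ p}` of a composite system with finitely many constituents `p`,
written in its product orthonormal basis `|x⟩ = ⨂_p |x p⟩`, where `x p < κ p`. -/
abbrev Space {P : Type} [Fintype P] (κ : P → ℕ) : Type :=
  EuclideanSpace ℂ (∀ p, Fin (κ p))

/-- Linear operators on `⨂_p ℂ^{κ p}`, as matrices in the product basis. -/
abbrev Op {P : Type} (κ : P → ℕ) : Type :=
  Matrix (∀ p, Fin (κ p)) (∀ p, Fin (κ p)) ℂ

/-- `O[p]`: the operator `O` on the constituent `p`, tensored with the identity on all others. -/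
def oneSite {P : Type} [Fintype P] [DecidableEq P] {κ : P → ℕ} (p : P)
    (O : Matrix (Fin (κ p)) (Fin (κ p)) ℂ) : Op κ :=
  fun x y => if ∀ l, l ≠ p → x l = y l then O (x p) (y p) else 0

/-- `h[p, q]` for `p ≠ q`: the operator `h` on `ℂ^{κ p} ⊗ ℂ^{κ q}`, tensored with the identity on
all constituents other than `p` and `q`. -/
def twoSite {P : Type} [Fintype P] [DecidableEq P] {κ : P → ℕ} (p q : P)
    (h : Matrix (Fin (κ p) × Fin (κ q)) (Fin (κ p) × Fin (κ q)) ℂ) : Op κ :=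
  fun x y => if ∀ l, l ≠ p → l ≠ q → x l = y l then h (x p, x q) (y p, y q) else 0

/-- The edges `(j, k)` of the interaction graph, each listed once, with `j < k`. -/
abbrev Edge {n : ℕ} (G : SimpleGraph (Fin n)) : Type :=
  {a : G.Dart // a.fst < a.snd}

/-- An instance of the 2-local common eigenspace problem for the particles `ℋ_j = ℂ^{d j}`:
pairwise commuting orthogonal projectors `Π_{jk} = h[j, k]`, one for each edge `(j, k)` of `G`. -/
structure Problem {n : ℕ} (G : SimpleGraph (Fin n)) (d : Fin n → ℕ) where
  proj : Edge G → Op d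
  isStarProjection : ∀ e, IsStarProjection (proj e)
  twoLocal : ∀ e, ∃ h, proj e = twoSite e.1.fst e.1.snd h
  commute : ∀ e e', Commute (proj e) (proj e')

/-- The common eigenspace `ℒ = {ψ | Π_{jk} ψ = ψ for all edges (j, k)}`. -/
def Problem.eigenspace {n : ℕ} {G : SimpleGraph (Fin n)} {d : Fin n → ℕ} (x : Problem G d) :
    Submodule ℂ (Space d) where
  carrier := {ψ | ∀ e, Matrix.toEuclideanLin (x.proj e) ψ = ψ}
  add_mem' := by
    intro a b ha hb e
    rw [map_add, ha e, hb e]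
  zero_mem' := by
    intro e
    exact map_zero _
  smul_mem' := by
    intro c a ha e
    rw [map_smul, ha e]

/-- The operators `O` on the particle `j` such that `O[j]` commutes with all projectors. -/
def Problem.localCommutant {n : ℕ} {G : SimpleGraph (Fin n)} {d : Fin n → ℕ} (x : Problem G d)
    (j : Fin n) : Set (Matrix (Fin (d j)) (Fin (d j)) ℂ) :=
  {O | ∀ e, oneSite j O * x.proj e = x.proj e * oneSite j O}

/-- Irreducibility: every `x.localCommutant j` consists of the scalar operators. -/
def Problem.Irreducible {n : ℕ} {G : SimpleGraph (Fin n)} {d : Fin n → ℕ} (x : Problem G d) :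
    Prop :=
  ∀ j, ∀ O ∈ x.localCommutant j, ∃ c : ℂ, O = c • 1

/-- A partition of the particles into blocks and subparticles: an orthogonal decomposition
`ℋ_j = ⨁_a ℋ_j^{(a)}`, with `a < numBlocks j`, together with tensor product structures
`ℋ_j^{(a)} = ℋ_{j.j}^{(a)} ⊗ ⨂_{k ~ j} ℋ_{j.k}^{(a)}` into nonzero factors. All of it is recorded by
the orthonormal basis `|a; f; (s_k)_{k ~ j}⟩` of `ℋ_j` which is adapted to it, that is, by a unitary
isomorphism of `ℋ_j` with `⨁_a ℂ^{freeDim j a} ⊗ ⨂_{k ~ j} ℂ^{subDim j a k}`. -/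
structure Partition {n : ℕ} (G : SimpleGraph (Fin n)) [DecidableRel G.Adj] (d : Fin n → ℕ) where
  numBlocks : Fin n → ℕ
  freeDim : ∀ j, Fin (numBlocks j) → ℕ
  subDim : ∀ j, Fin (numBlocks j) → G.neighborSet j → ℕ
  freeDim_pos : ∀ j a, 0 < freeDim j a
  subDim_pos : ∀ j a k, 0 < subDim j a k
  basis : ∀ j, OrthonormalBasis
    (Σ a : Fin (numBlocks j), Fin (freeDim j a) × ∀ k : G.neighborSet j, Fin (subDim j a k))
    ℂ (EuclideanSpace ℂ (Fin (d j)))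

section

variable {n : ℕ} {G : SimpleGraph (Fin n)} [DecidableRel G.Adj] {d : Fin n → ℕ}

/-- A choice `α = (α_1, …, α_n)` of one block for each particle. -/
abbrev Partition.Label (D : Partition G d) : Type :=
  ∀ j, Fin (D.numBlocks j)

/-- The dimensions of the factors of
`ℋ^{(α)} = (⨂_j ℋ_{j.j}^{(α_j)}) ⊗ (⨂_j ⨂_{k ~ j} ℋ_{j.k}^{(α_j)})`: the constituent `inl j` is the
free factor `j.j`, and for a directed edge `a = (j, k)` the constituent `inr a` is the subparticle
`j.k`. -/
def Partition.fineDim (D : Partition G d) (α : D.Label) : Fin n ⊕ G.Dart → ℕ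
  | .inl j => D.freeDim j (α j)
  | .inr a => D.subDim a.fst (α a.fst) ⟨a.snd, a.adj⟩

/-- The isometric inclusion of `ℋ^{(α)}`, written in the product basis of its fine factors, into
`ℋ = ⨂_j ℋ_j`. It maps `|y⟩` to `⨂_j |α_j; y_{j.j}; (y_{j.k})_{k ~ j}⟩`. -/
def Partition.incl (D : Partition G d) (α : D.Label) :
    Matrix (∀ j, Fin (d j)) (∀ s, Fin (D.fineDim α s)) ℂ :=
  fun x y => ∏ j, D.basis j ⟨α j, y (.inl j), fun k => y (.inr ⟨(j, k), k.2⟩)⟩ (x j)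

/-- The subspace `ℋ^{(α)} = ⨂_j ℋ_j^{(α_j)}` of `ℋ`. -/
def Partition.block (D : Partition G d) (α : D.Label) : Submodule ℂ (Space d) :=
  LinearMap.range (Matrix.toEuclideanLin (D.incl α))

/-- The basis indices of `ℋ_{j.k}^{(a)} ⊗ ℋ_{k.j}^{(b)}` for the edge `e = (j, k)`. -/
abbrev Partition.PairIdx (D : Partition G d) (e : Edge G)
    (a : Fin (D.numBlocks e.1.fst)) (b : Fin (D.numBlocks e.1.snd)) : Type :=
  Fin (D.subDim e.1.fst a ⟨e.1.snd, e.1.adj⟩) × Fin (D.subDim e.1.snd b ⟨e.1.fst, e.1.adj.symm⟩)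

/-- A family of operators `h_{jk}^{(a b)}` on `ℋ_{j.k}^{(a)} ⊗ ℋ_{k.j}^{(b)}`. -/
abbrev Partition.PairOps (D : Partition G d) : Type :=
  ∀ (e : Edge G) (a : Fin (D.numBlocks e.1.fst)) (b : Fin (D.numBlocks e.1.snd)),
    Matrix (D.PairIdx e a b) (D.PairIdx e a b) ℂ

/-- `Π_{jk} = ⨁_α h_{jk}^{(α_j α_k)}[j.k, k.j]`: each `Π_{jk}` preserves each `ℋ^{(α)}`, and it acts
there only on the two subparticles `j.k` and `k.j`. -/
def Partition.Localizes (D : Partition G d) (h : D.PairOps) (x : Problem G d) : Prop :=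
  ∀ (e : Edge G) (α : D.Label),
    x.proj e * D.incl α = D.incl α *
      twoSite (κ := D.fineDim α) (.inr e.1) (.inr e.1.symm) (h e (α e.1.fst) (α e.1.snd))

/-- The product vector `(⨂_j v_j) ⊗ (⨂_{(j,k)} w_{jk})` in `ℋ^{(α)}`, where `v_j` lies in the free
factor `ℋ_{j.j}^{(α_j)}` and `w_{jk}` in `ℋ_{j.k}^{(α_j)} ⊗ ℋ_{k.j}^{(α_k)}`. -/
def Partition.productVector (D : Partition G d) (α : D.Label)
    (v : ∀ j, EuclideanSpace ℂ (Fin (D.freeDim j (α j))))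
    (w : ∀ e : Edge G, EuclideanSpace ℂ (D.PairIdx e (α e.1.fst) (α e.1.snd))) :
    Space (D.fineDim α) :=
  WithLp.toLp 2 fun y =>
    (∏ j, v j (y (.inl j))) * ∏ e : Edge G, w e (y (.inr e.1), y (.inr e.1.symm))

/-- The subspace `(⨂_j ℋ_{j.j}^{(α_j)}) ⊗ (⨂_{(j,k)} ℳ_{jk}^{(α_j α_k)})` of `ℋ`, where
`ℳ_{jk}^{(a b)} = {φ ∈ ℋ_{j.k}^{(a)} ⊗ ℋ_{k.j}^{(b)} | h_{jk}^{(a b)} φ = φ}`. -/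
def Partition.pairSpace (D : Partition G d) (h : D.PairOps) (α : D.Label) :
    Submodule ℂ (Space d) :=
  Submodule.span ℂ
    {ψ | ∃ v w, (∀ e, Matrix.toEuclideanLin (h e (α e.1.fst) (α e.1.snd)) (w e) = w e) ∧
      ψ = Matrix.toEuclideanLin (D.incl α) (D.productVector α v w)}

/-- The common eigenspace is the orthogonal direct sum over `α` of the spaces
`ℒ ∩ ℋ^{(α)} = (⨂_j ℋ_{j.j}^{(α_j)}) ⊗ (⨂_{(j,k)} ℳ_{jk}^{(α_j α_k)})`. -/
def Partition.SplitsEigenspace (D : Partition G d) (h : D.PairOps) (x : Problem G d) : Prop :=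
  x.eigenspace = ⨆ α, x.eigenspace ⊓ D.block α ∧
  (Pairwise fun α β : D.Label => D.block α ⟂ D.block β) ∧
  ∀ α, x.eigenspace ⊓ D.block α = D.pairSpace h α

end

end CES

end

/-! Cut each projector `Π_{jk}` at particle `j`: fixing matrix indices on all other particles leaves
operators on `ℋ_j`, its slices. Three facts make these useful. Slices of `Π_{jk}` at `j` are closed
under adjoints, since `Π_{jk}` is self-adjoint. Slices of `Π_{jk}` and `Π_{jl}` with `k ≠ l`
commute, since in a product of the two projectors the indices at `k` and `l` are touched by one
factor each, so commutation can be read off entry by entry (`slice_mul_slice_comm`). And a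
two-particle operator is determined by its slices.

An adjoint-closed set of operators on a finite-dimensional space splits the space as `⨁_a F_a ⊗
M_a`, with the set acting on the `M_a` and its centralizer on the `F_a` (`exists_isotypic_basis`).
Several mutually commuting adjoint-closed sets are handled by induction: split by one of them,
observe that the others act on the `F_a`, and recurse there (`exists_tensorBasis`). Applied to the
slices at `j`, one set for each neighbour `k`, this yields the blocks and the factors `j.k`; what
remains at the end is the free factor `j.j`. If the slices of `Π_{jk}` at both ends act on single
factors, the operator itself acts only on `j.k` and `k.j` (`exists_pairOp`, `exists_localizes`).

Everything else follows from localization. The blocks give a resolution of the identity intertwined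
with the projectors, and within a block operators of different edges act on disjoint pairs of
factors, so their common fixed space is spanned by products of fixed vectors
(`Partition.Localizes.splitsEigenspace`). Operators diagonal in the block label and the free index
commute with the family, so irreducibility leaves one block and one-dimensional free factors
(`Partition.Localizes.subsingleton_free`). With one block, nonzero projectors give nonzero
idempotents `h_{jk}`, and a product of nonzero fixed vectors is a nonzero element of `ℒ`. -/

noncomputable section
namespace CES

open scoped InnerProductSpace

/-! ### Isotypic decomposition for an adjoint-closed set of operators and its centralizer. -/

section Isotypic

variable {H : Type*} [NormedAddCommGroup H] [InnerProductSpace ℂ H]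

/-- `W` is invariant under all operators in `S`. -/
def InvariantUnder (S : Set (Module.End ℂ H)) (W : Submodule ℂ H) : Prop :=
  ∀ T ∈ S, ∀ x ∈ W, T x ∈ W

theorem InvariantUnder.inf {S : Set (Module.End ℂ H)} {V W : Submodule ℂ H}
    (hV : InvariantUnder S V) (hW : InvariantUnder S W) : InvariantUnder S (V ⊓ W) :=
  fun T hT x hx => ⟨hV T hT x hx.1, hW T hT x hx.2⟩

theorem invariantUnder_span {S : Set (Module.End ℂ H)} {s : Set H}
    (h : ∀ T ∈ S, ∀ x ∈ s, T x ∈ Submodule.span ℂ s) : InvariantUnder S (Submodule.span ℂ s) := by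
  intro T hT x hx
  have : Submodule.span ℂ s ≤ (Submodule.span ℂ s).comap T :=
    Submodule.span_le.2 fun y hy => h T hT y hy
  exact this hx

variable [FiniteDimensional ℂ H]

/-- `S` is closed under taking adjoints. -/
def AdjointClosed (S : Set (Module.End ℂ H)) : Prop :=
  ∀ T ∈ S, LinearMap.adjoint T ∈ S

theorem AdjointClosed.centralizer {S : Set (Module.End ℂ H)} (hS : AdjointClosed S) :
    AdjointClosed (Set.centralizer S) := by
  intro B hB T hT
  have h := congrArg LinearMap.adjoint (hB _ (hS T hT))
  simp only [Module.End.mul_eq_comp, LinearMap.adjoint_comp, LinearMap.adjoint_adjoint] at h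
  exact h.symm

theorem InvariantUnder.orthogonal {S : Set (Module.End ℂ H)} (hS : AdjointClosed S)
    {W : Submodule ℂ H} (hW : InvariantUnder S W) : InvariantUnder S Wᗮ := by
  intro T hT x hx
  rw [Submodule.mem_orthogonal] at hx ⊢
  intro u hu
  rw [← LinearMap.adjoint_inner_left]
  exact hx _ (hW _ (hS T hT) u hu)

/-- `M` is a minimal nonzero invariant subspace for `S`. -/
structure IsMinimalInvariant (S : Set (Module.End ℂ H)) (M : Submodule ℂ H) : Prop where
  invariant : InvariantUnder S M
  ne_bot : M ≠ ⊥
  eq_of_le : ∀ N ≤ M, N ≠ ⊥ → InvariantUnder S N → N = M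

theorem exists_isMinimalInvariant_le {S : Set (Module.End ℂ H)} {W : Submodule ℂ H}
    (hW : InvariantUnder S W) (h0 : W ≠ ⊥) : ∃ M ≤ W, IsMinimalInvariant S M := by
  obtain ⟨M, ⟨hM1, hM2, hM3⟩, hmin⟩ := exists_minimal_of_wellFoundedLT
    (fun N : Submodule ℂ H => N ≤ W ∧ N ≠ ⊥ ∧ InvariantUnder S N) ⟨W, le_rfl, h0, hW⟩
  exact ⟨M, hM1, hM3, hM2, fun N hN hN0 hN1 =>
    le_antisymm hN (hmin ⟨hN.trans hM1, hN0, hN1⟩ hN)⟩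

/-- Schur's lemma, for compressions to a minimal invariant subspace. -/
theorem IsMinimalInvariant.exists_scalar {S : Set (Module.End ℂ H)} (hS : AdjointClosed S)
    {M : Submodule ℂ H} (hM : IsMinimalInvariant S M) {B : Module.End ℂ H}
    (hB : B ∈ Set.centralizer S) :
    ∃ c : ℂ, ∀ m ∈ M, ∀ m' ∈ M, ⟪m, B m'⟫_ℂ = c * ⟪m, m'⟫_ℂ := by
  have : Nontrivial M := (Submodule.nontrivial_iff_ne_bot).2 hM.ne_bot
  let C : Module.End ℂ M := M.orthogonalProjectionOnto.toLinearMap ∘ₗ B ∘ₗ M.subtype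
  obtain ⟨c, hc⟩ := Module.End.exists_eigenvalue C
  obtain ⟨v, hv⟩ := hc.exists_hasEigenvector
  -- The eigenspace of the compression `C` for the eigenvalue `c`, phrased through inner products;
  -- it is invariant, so minimality makes it all of `M`.
  let N : Submodule ℂ H :=
    { carrier := {x | x ∈ M ∧ ∀ m ∈ M, ⟪m, B x⟫_ℂ = c * ⟪m, x⟫_ℂ}
      add_mem' := by
        rintro a b ⟨ha, ha'⟩ ⟨hb, hb'⟩
        refine ⟨M.add_mem ha hb, fun m hm => ?_⟩
        rw [map_add, inner_add_right, inner_add_right, ha' m hm, hb' m hm, mul_add]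
      zero_mem' := ⟨M.zero_mem, fun m _ => by simp⟩
      smul_mem' := by
        rintro r a ⟨ha, ha'⟩
        refine ⟨M.smul_mem r ha, fun m hm => ?_⟩
        rw [map_smul, inner_smul_right, inner_smul_right, ha' m hm]
        ring }
  have hN : N = M := by
    refine hM.eq_of_le N (fun x hx => hx.1) ?_ ?_
    · intro h
      have hvN : (v : H) ∈ N := by
        refine ⟨v.2, fun m hm => ?_⟩
        have h1 : ((C v : M) : H) = c • (v : H) := by rw [hv.apply_eq_smul]; rfl
        have h2 : ⟪m, B v⟫_ℂ = ⟪m, ((C v : M) : H)⟫_ℂ := by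
          have := Submodule.inner_orthogonalProjectionOnto_eq_of_mem_left (K := M) ⟨m, hm⟩ (B v)
          exact this.symm
        rw [h2, h1, inner_smul_right]
      rw [h, Submodule.mem_bot] at hvN
      exact hv.2 (Subtype.ext hvN)
    · rintro T hT x ⟨hx, hx'⟩
      refine ⟨hM.invariant T hT x hx, fun m hm => ?_⟩
      have h1 : B (T x) = T (B x) := (LinearMap.congr_fun (hB T hT) x).symm
      rw [h1, ← LinearMap.adjoint_inner_left, hx' _ (hM.invariant _ (hS T hT) m hm),
        LinearMap.adjoint_inner_left]
  refine ⟨c, fun m hm m' hm' => ?_⟩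
  rw [← hN] at hm'
  exact hm'.2 m hm

/-- The isotypic component generated by a minimal invariant subspace has an orthonormal basis
`c (f, i)` such that `S` acts on the index `i` and the centralizer of `S` on the index `f`. -/
theorem IsMinimalInvariant.exists_orthonormal {S : Set (Module.End ℂ H)} (hS : AdjointClosed S)
    {M : Submodule ℂ H} (hM : IsMinimalInvariant S M) :
    ∃ (p q : ℕ) (c : Fin p × Fin q → H), 0 < p ∧ 0 < q ∧ Orthonormal ℂ c ∧
      (∀ T ∈ S, ∃ X : Matrix (Fin q) (Fin q) ℂ, ∀ f i, T (c (f, i)) = ∑ i', X i' i • c (f, i')) ∧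
      (∀ B ∈ Set.centralizer S, ∃ Y : Matrix (Fin p) (Fin p) ℂ,
        ∀ f i, B (c (f, i)) = ∑ f', Y f' f • c (f', i)) ∧
      M ≤ Submodule.span ℂ (Set.range c) ∧
      ∀ k, ∃ B ∈ Set.centralizer S, ∃ m ∈ M, c k = B m := by
  obtain ⟨z, hzM, hz0⟩ := M.ne_bot_iff.1 hM.ne_bot
  obtain ⟨m₀, hm₀, hn⟩ : ∃ m₀ ∈ M, ‖m₀‖ = 1 :=
    ⟨((‖z‖⁻¹ : ℝ) : ℂ) • z, M.smul_mem _ hzM, by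
      simp [norm_smul, inv_mul_cancel₀ (norm_ne_zero_iff.2 hz0)]⟩
  -- Schur's lemma for `B* B'`, its scalar being evaluated at the unit vector `m₀`. This says that
  -- `B m₀ ⊗ m ↦ B m` is isometric.
  have key : ∀ B ∈ Set.centralizer S, ∀ B' ∈ Set.centralizer S, ∀ m ∈ M, ∀ m' ∈ M,
      ⟪B m, B' m'⟫_ℂ = ⟪B m₀, B' m₀⟫_ℂ * ⟪m, m'⟫_ℂ := by
    intro B hB B' hB' m hm m' hm'
    obtain ⟨c, hc⟩ := hM.exists_scalar hS
      (Set.mul_mem_centralizer (hS.centralizer B hB) hB')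
    have h1 : ∀ x y, ⟪B x, B' y⟫_ℂ = ⟪x, (LinearMap.adjoint B * B') y⟫_ℂ := by
      intro x y
      rw [Module.End.mul_apply, LinearMap.adjoint_inner_right]
    rw [h1, h1, hc m hm m' hm', hc m₀ hm₀ m₀ hm₀, inner_self_eq_norm_sq_to_K, hn]
    simp
  -- The multiplicity space: the orbit of `m₀` under the centralizer.
  let V : Submodule ℂ H :=
    (Subalgebra.toSubmodule (Subalgebra.centralizer ℂ S)).map (LinearMap.applyₗ m₀)
  have hV : ∀ B ∈ Set.centralizer S, B m₀ ∈ V := fun B hB =>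
    Submodule.mem_map.2 ⟨B, (hB : B ∈ Subalgebra.centralizer ℂ S), rfl⟩
  let v := stdOrthonormalBasis ℂ V
  let u := stdOrthonormalBasis ℂ M
  have hb : ∀ f, ∃ B ∈ Set.centralizer S, B m₀ = v f := by
    intro f
    obtain ⟨B, hB, h⟩ := Submodule.mem_map.1 (v f).2
    exact ⟨B, hB, h⟩
  choose b hbS hbv using hb
  -- On `M`, a centralizer element is determined by its value at `m₀`: by `key`, one that kills `m₀`
  -- kills `M`.
  have expand : ∀ B (hB : B ∈ Set.centralizer S), ∀ m ∈ M,
      B m = ∑ f, v.repr ⟨B m₀, hV B hB⟩ f • b f m := by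
    intro B hB m hm
    let D : Module.End ℂ H := B - ∑ f, v.repr ⟨B m₀, hV B hB⟩ f • b f
    have hD : D ∈ Subalgebra.centralizer ℂ S :=
      Subalgebra.sub_mem _ (show B ∈ Subalgebra.centralizer ℂ S from hB)
        (Subalgebra.sum_mem _ fun f _ => Subalgebra.smul_mem _ (hbS f) _)
    have h0 : D m₀ = 0 := by
      have := congrArg Subtype.val (v.sum_repr ⟨B m₀, hV B hB⟩)
      simp only [Submodule.coe_sum, Submodule.coe_smul] at this
      simp [D, hbv, this]
    have h1 := key D hD D hD m hm m hm
    rw [h0, inner_zero_left, zero_mul, inner_self_eq_zero] at h1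
    simpa [D, sub_eq_zero] using h1
  let c : Fin _ × Fin _ → H := fun k => b k.1 (u k.2)
  have hVpos : 0 < Module.finrank ℂ V := by
    rw [Module.finrank_pos_iff]
    refine ⟨⟨⟨m₀, hV 1 (Set.one_mem_centralizer)⟩, 0, fun h => ?_⟩⟩
    have h' : m₀ = 0 := congrArg Subtype.val h
    simp [h'] at hn
  have hMpos : 0 < Module.finrank ℂ M := by
    rw [Module.finrank_pos_iff]
    exact (Submodule.nontrivial_iff_ne_bot).2 hM.ne_bot
  refine ⟨_, _, c, hVpos, hMpos, ?_, ?_, ?_, ?_, ?_⟩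
  · rw [orthonormal_iff_ite]
    rintro ⟨f, i⟩ ⟨f', i'⟩
    have h1 := orthonormal_iff_ite.1 v.orthonormal f f'
    have h2 := orthonormal_iff_ite.1 u.orthonormal i i'
    rw [Submodule.coe_inner] at h1 h2
    simp only [c]
    rw [key _ (hbS f) _ (hbS f') _ (u i).2 _ (u i').2, hbv, hbv, h1, h2]
    simp only [Prod.mk.injEq]
    by_cases hf : f = f' <;> by_cases hi : i = i' <;> simp [hf, hi]
  · intro T hT
    refine ⟨fun i' i => u.repr ⟨T (u i), hM.invariant T hT _ (u i).2⟩ i', fun f i => ?_⟩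
    have h1 : T (b f (u i)) = b f (T (u i)) := LinearMap.congr_fun (hbS f T hT) (u i)
    have h2 := congrArg Subtype.val (u.sum_repr ⟨T (u i), hM.invariant T hT _ (u i).2⟩)
    simp only [Submodule.coe_sum, Submodule.coe_smul] at h2
    simp only [c]
    conv_lhs => rw [h1, ← h2]
    simp
  · intro B hB
    refine ⟨fun f' f => v.repr ⟨(B * b f) m₀, hV _ (Set.mul_mem_centralizer hB (hbS f))⟩ f',
      fun f i => ?_⟩
    exact expand (B * b f) (Set.mul_mem_centralizer hB (hbS f)) (u i) (u i).2
  · intro m hm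
    have h1 := expand 1 (Set.one_mem_centralizer) m hm
    rw [Module.End.one_apply] at h1
    rw [h1]
    refine Submodule.sum_mem _ fun f _ => Submodule.smul_mem _ _ ?_
    have h2 := congrArg Subtype.val (u.sum_repr ⟨m, hm⟩)
    simp only [Submodule.coe_sum, Submodule.coe_smul] at h2
    rw [← h2, map_sum]
    refine Submodule.sum_mem _ fun i _ => ?_
    rw [map_smul]
    exact Submodule.smul_mem _ _ (Submodule.subset_span ⟨(f, i), rfl⟩)
  · rintro ⟨f, i⟩
    exact ⟨b f, hbS f, u i, (u i).2, rfl⟩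

/-- Induction on dimension. An isotypic component is invariant under `S` and its centralizer; as
both are adjoint-closed, so is its orthogonal complement, and the induction continues there. -/
theorem exists_isotypic_orthonormal {S : Set (Module.End ℂ H)} (hS : AdjointClosed S)
    (N : ℕ) : ∀ W : Submodule ℂ H, Module.finrank ℂ W ≤ N → InvariantUnder S W →
      InvariantUnder (Set.centralizer S) W →
      ∃ (r : ℕ) (p q : Fin r → ℕ) (c : (Σ a, Fin (p a) × Fin (q a)) → H),
        (∀ a, 0 < p a) ∧ (∀ a, 0 < q a) ∧ Orthonormal ℂ c ∧ Submodule.span ℂ (Set.range c) = W ∧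
        (∀ T ∈ S, ∃ X : ∀ a, Matrix (Fin (q a)) (Fin (q a)) ℂ,
          ∀ a f i, T (c ⟨a, f, i⟩) = ∑ i', X a i' i • c ⟨a, f, i'⟩) ∧
        (∀ B ∈ Set.centralizer S, ∃ Y : ∀ a, Matrix (Fin (p a)) (Fin (p a)) ℂ,
          ∀ a f i, B (c ⟨a, f, i⟩) = ∑ f', Y a f' f • c ⟨a, f', i⟩) := by
  induction N with
  | zero =>
    intro W hW _ _
    have hW0 : W = ⊥ := Submodule.finrank_eq_zero.1 (Nat.le_zero.1 hW)
    refine ⟨0, Fin.elim0, Fin.elim0, fun k => k.1.elim0, fun a => a.elim0, fun a => a.elim0,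
      ⟨fun k => k.1.elim0, fun k => k.1.elim0⟩, ?_,
      fun T _ => ⟨fun a => a.elim0, fun a => a.elim0⟩,
      fun T _ => ⟨fun a => a.elim0, fun a => a.elim0⟩⟩
    rw [hW0, Submodule.span_eq_bot]
    rintro _ ⟨k, rfl⟩
    exact k.1.elim0
  | succ N ih =>
    intro W hW hWS hWC
    by_cases h0 : W = ⊥
    · exact ih W (by rw [h0, finrank_bot]; exact Nat.zero_le _) hWS hWC
    obtain ⟨M, hMW, hM⟩ := exists_isMinimalInvariant_le hWS h0
    obtain ⟨p₀, q₀, c₀, hp₀, hq₀, ho₀, hT₀, hB₀, hMc, hcM⟩ := hM.exists_orthonormal hS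
    set W₁ := Submodule.span ℂ (Set.range c₀) with hW₁
    have hle : W₁ ≤ W := by
      refine Submodule.span_le.2 ?_
      rintro _ ⟨k, rfl⟩
      obtain ⟨B, hB, m, hm, h⟩ := hcM k
      rw [h]
      exact hWC B hB m (hMW hm)
    have h1S : InvariantUnder S W₁ := by
      refine invariantUnder_span ?_
      rintro T hT _ ⟨⟨f, i⟩, rfl⟩
      obtain ⟨X, hX⟩ := hT₀ T hT
      rw [hX]
      exact Submodule.sum_mem _ fun i' _ => Submodule.smul_mem _ _
        (Submodule.subset_span ⟨_, rfl⟩)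
    have h1C : InvariantUnder (Set.centralizer S) W₁ := by
      refine invariantUnder_span ?_
      rintro T hT _ ⟨⟨f, i⟩, rfl⟩
      obtain ⟨X, hX⟩ := hB₀ T hT
      rw [hX]
      exact Submodule.sum_mem _ fun i' _ => Submodule.smul_mem _ _
        (Submodule.subset_span ⟨_, rfl⟩)
    -- The complement of `W₁` in `W` is strictly smaller, because `M` lies in `W₁` and is nonzero.
    have hsup : W₁ ⊔ W₁ᗮ ⊓ W = W := Submodule.sup_orthogonal_inf_of_hasOrthogonalProjection hle
    have hlt : W₁ᗮ ⊓ W < W := by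
      refine lt_of_le_of_ne inf_le_right fun h => hM.ne_bot ?_
      have hMo : M ≤ W₁ᗮ := hMW.trans (h ▸ inf_le_left)
      rw [eq_bot_iff, ← Submodule.inf_orthogonal_eq_bot W₁]
      exact le_inf hMc hMo
    obtain ⟨r, p, q, c, hp, hq, ho, hsp, hT, hB⟩ := ih (W₁ᗮ ⊓ W)
      (Nat.lt_succ_iff.1 ((Submodule.finrank_lt_finrank_of_lt hlt).trans_le hW))
      ((h1S.orthogonal hS).inf hWS) ((h1C.orthogonal hS.centralizer).inf hWC)
    have hc : ∀ k, c k ∈ W₁ᗮ := fun k =>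
      (hsp.le (Submodule.subset_span ⟨k, rfl⟩)).1
    have hc₀ : ∀ k, c₀ k ∈ W₁ := fun k => Submodule.subset_span ⟨k, rfl⟩
    let P : Fin (r + 1) → ℕ := Fin.cons p₀ p
    let Q : Fin (r + 1) → ℕ := Fin.cons q₀ q
    let C : ∀ a : Fin (r + 1), Fin (P a) × Fin (Q a) → H :=
      Fin.cases c₀ fun a k => c ⟨a, k⟩
    have hrange : Set.range (fun k : Σ a, Fin (P a) × Fin (Q a) => C k.1 k.2) =
        Set.range c₀ ∪ Set.range c := by
      ext x
      constructor
      · rintro ⟨⟨a, k⟩, rfl⟩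
        induction a using Fin.cases with
        | zero => exact Or.inl ⟨k, rfl⟩
        | succ a => exact Or.inr ⟨⟨a, k⟩, rfl⟩
      · rintro (⟨k, rfl⟩ | ⟨⟨a, k⟩, rfl⟩)
        · exact ⟨⟨0, k⟩, rfl⟩
        · exact ⟨⟨a.succ, k⟩, rfl⟩
    refine ⟨r + 1, P, Q, fun k => C k.1 k.2, ?_, ?_, ⟨?_, ?_⟩, ?_, ?_, ?_⟩
    · exact Fin.cases hp₀ hp
    · exact Fin.cases hq₀ hq
    · rintro ⟨a, k⟩
      induction a using Fin.cases with
      | zero => exact ho₀.1 k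
      | succ a => exact ho.1 ⟨a, k⟩
    · rintro ⟨a, k⟩ ⟨a', k'⟩ hne
      induction a using Fin.cases with
      | zero =>
        induction a' using Fin.cases with
        | zero => exact ho₀.2 fun h => hne (congrArg (Sigma.mk (0 : Fin (r + 1))) h)
        | succ a' => exact Submodule.inner_right_of_mem_orthogonal (hc₀ k) (hc ⟨a', k'⟩)
      | succ a =>
        induction a' using Fin.cases with
        | zero => exact Submodule.inner_left_of_mem_orthogonal (hc₀ k') (hc ⟨a, k⟩)
        | succ a' =>
          refine ho.2 (i := ⟨a, k⟩) (j := ⟨a', k'⟩) fun h => hne ?_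
          obtain ⟨rfl, h⟩ := Sigma.mk.inj_iff.1 h
          rw [eq_of_heq h]
    · rw [hrange, Submodule.span_union, hsp, hsup]
    · intro T hTS
      obtain ⟨X₀, hX₀⟩ := hT₀ T hTS
      obtain ⟨X, hX⟩ := hT T hTS
      exact ⟨Fin.cases X₀ X, Fin.cases hX₀ hX⟩
    · intro B hBS
      obtain ⟨X₀, hX₀⟩ := hB₀ B hBS
      obtain ⟨X, hX⟩ := hB B hBS
      exact ⟨Fin.cases X₀ X, Fin.cases hX₀ hX⟩

/-- The orthogonal decomposition `⨁_a F_a ⊗ M_a` of a Hilbert space on which an adjoint-closed set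
of operators acts on the factors `M_a` and its centralizer on the factors `F_a`. -/
theorem exists_isotypic_basis {S : Set (Module.End ℂ H)} (hS : AdjointClosed S) :
    ∃ (r : ℕ) (p q : Fin r → ℕ) (c : OrthonormalBasis (Σ a, Fin (p a) × Fin (q a)) ℂ H),
      (∀ a, 0 < p a) ∧ (∀ a, 0 < q a) ∧
      (∀ T ∈ S, ∃ X : ∀ a, Matrix (Fin (q a)) (Fin (q a)) ℂ,
        ∀ a f i, T (c ⟨a, f, i⟩) = ∑ i', X a i' i • c ⟨a, f, i'⟩) ∧
      (∀ B ∈ Set.centralizer S, ∃ Y : ∀ a, Matrix (Fin (p a)) (Fin (p a)) ℂ,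
        ∀ a f i, B (c ⟨a, f, i⟩) = ∑ f', Y a f' f • c ⟨a, f', i⟩) := by
  obtain ⟨r, p, q, c, hp, hq, ho, hsp, hT, hB⟩ := exists_isotypic_orthonormal hS _ ⊤ le_rfl
    (fun _ _ _ _ => Submodule.mem_top) (fun _ _ _ _ => Submodule.mem_top)
  refine ⟨r, p, q, OrthonormalBasis.mk ho hsp.ge, hp, hq, ?_, ?_⟩
  · simpa only [OrthonormalBasis.coe_mk] using hT
  · simpa only [OrthonormalBasis.coe_mk] using hB

end Isotypic

/-! ### Simultaneous tensor factorization for commuting adjoint-closed sets. -/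

section TensorBasis

/-- `T` acts only on the tensor factor `k` of each summand of `⨁_a ℂ^{p a} ⊗ ⨂_k ℂ^{q a k}`, in
terms of the adapted family of vectors `b`. -/
def ActsOn {H : Type*} [AddCommGroup H] [Module ℂ H] {K A : Type*} [DecidableEq K] {p : A → ℕ}
    {q : A → K → ℕ} (b : (Σ a, Fin (p a) × ∀ k, Fin (q a k)) → H) (k : K)
    (T : Module.End ℂ H) : Prop :=
  ∃ m : ∀ a, Matrix (Fin (q a k)) (Fin (q a k)) ℂ, ∀ a f s,
    T (b ⟨a, f, s⟩) = ∑ t, m a t (s k) • b ⟨a, f, Function.update s k t⟩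

/-- There is an orthogonal decomposition `H = ⨁_a ℂ^{p a} ⊗ ⨂_k ℂ^{q a k}` such that all operators
in `S k` act only on the tensor factors `k`. -/
def HasTensorBasis {K H : Type} [DecidableEq K] [Fintype K] [NormedAddCommGroup H]
    [InnerProductSpace ℂ H] (S : K → Set (Module.End ℂ H)) : Prop :=
  ∃ (r : ℕ) (p : Fin r → ℕ) (q : Fin r → K → ℕ)
    (b : OrthonormalBasis (Σ a, Fin (p a) × ∀ k, Fin (q a k)) ℂ H),
    (∀ a, 0 < p a) ∧ (∀ a k, 0 < q a k) ∧ ∀ k, ∀ T ∈ S k, ActsOn b k T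

variable {H : Type} [NormedAddCommGroup H] [InnerProductSpace ℂ H]

/-- Frees the constructions below from the bookkeeping of `HasTensorBasis`: blocks may be labelled
by any finite type and factors relabelled along a bijection. -/
theorem HasTensorBasis.of_basis {K L A : Type} [DecidableEq K] [Fintype K] [DecidableEq L]
    [Fintype L] [Fintype A] (σ : K ≃ L) {S : K → Set (Module.End ℂ H)} {p : A → ℕ}
    {q : A → L → ℕ} (b : OrthonormalBasis (Σ a, Fin (p a) × ∀ l, Fin (q a l)) ℂ H)
    (hp : ∀ a, 0 < p a) (hq : ∀ a l, 0 < q a l) (hS : ∀ k, ∀ T ∈ S k, ActsOn b (σ k) T) :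
    HasTensorBasis S := by
  let ε := (Fintype.equivFin A).symm
  let G : ∀ a, (∀ k, Fin (q (ε a) (σ k))) ≃ ∀ l, Fin (q (ε a) l) := fun a =>
    Equiv.piCongr σ fun k => Equiv.refl _
  have hG : ∀ a s k, G a s (σ k) = s k := fun a s k =>
    Equiv.piCongr_apply_apply (h₁ := σ) (Z := fun l => Fin (q (ε a) l)) _ s k
  have hu : ∀ a s k t, G a (Function.update s k t) = Function.update (G a s) (σ k) t := by
    intro a s k t
    funext l
    obtain ⟨k', rfl⟩ := σ.surjective l
    rw [hG]
    by_cases h : k' = k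
    · subst h
      simp
    · rw [Function.update_of_ne h, Function.update_of_ne (fun h' => h (σ.injective h')), hG]
  let E : (Σ a, Fin (p (ε a)) × ∀ k, Fin (q (ε a) (σ k))) ≃ Σ a, Fin (p a) × ∀ l, Fin (q a l) :=
    Equiv.sigmaCongr ε fun a => Equiv.prodCongr (Equiv.refl _) (G a)
  refine ⟨Fintype.card A, fun a => p (ε a), fun a k => q (ε a) (σ k), b.reindex E.symm,
    fun a => hp _, fun a k => hq _ _, fun k T hT => ?_⟩
  obtain ⟨m, hm⟩ := hS k T hT
  have hb : ∀ a f s, b.reindex E.symm ⟨a, f, s⟩ = b ⟨ε a, f, G a s⟩ := by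
    intro a f s
    rw [OrthonormalBasis.reindex_apply]
    rfl
  refine ⟨fun a => m (ε a), fun a f s => ?_⟩
  simp only [hb, hu, hm, hG]

/-- Induction step. Decompose by `S none`; the remaining sets lie in its centralizer, hence act on
the multiplicity spaces `ℂ^{p a}`. There they are still adjoint-closed and commuting, so `ih`
factors these spaces further, and the factor for `none` is tensored back on. -/
theorem exists_tensorBasis_option {K : Type} [Fintype K] [DecidableEq K] [FiniteDimensional ℂ H]
    (ih : ∀ (n : ℕ), 0 < n → ∀ S : K → Set (Module.End ℂ (EuclideanSpace ℂ (Fin n))),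
      (∀ k, AdjointClosed (S k)) →
      (∀ k l, k ≠ l → ∀ T ∈ S k, ∀ T' ∈ S l, T * T' = T' * T) → HasTensorBasis S)
    [DecidableEq (Option K)] {S : Option K → Set (Module.End ℂ H)} (hS : ∀ k, AdjointClosed (S k))
    (hcomm : ∀ k l, k ≠ l → ∀ T ∈ S k, ∀ T' ∈ S l, T * T' = T' * T) :
    HasTensorBasis S := by
  obtain ⟨r, p, q, c, hp, hq, hX, hY⟩ := exists_isotypic_basis (hS none)
  -- `J a i` embeds the multiplicity space isometrically as the slot `ξ ⊗ |i⟩` of block `a`.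
  let J : ∀ a, Fin (q a) → EuclideanSpace ℂ (Fin (p a)) →ₗ[ℂ] H := fun a i =>
    { toFun := fun ξ => ∑ f, ξ f • c ⟨a, f, i⟩
      map_add' := fun ξ η => by simp [add_smul, Finset.sum_add_distrib]
      map_smul' := fun z ξ => by simp [Finset.smul_sum, mul_smul] }
  have hJ : ∀ a i ξ, J a i ξ = ∑ f, ξ f • c ⟨a, f, i⟩ := fun _ _ _ => rfl
  have hJin : ∀ a i ξ i' η, ⟪J a i ξ, J a i' η⟫_ℂ = if i = i' then ⟪ξ, η⟫_ℂ else 0 := by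
    intro a i ξ i' η
    simp only [hJ, sum_inner, inner_sum, inner_smul_left, inner_smul_right,
      orthonormal_iff_ite.1 c.orthonormal, PiLp.inner_apply]
    by_cases h : i = i'
    · subst h
      simp [mul_comm]
    · simp [h]
  have hJne : ∀ a i ξ a' i' η, a ≠ a' → ⟪J a i ξ, J a' i' η⟫_ℂ = 0 := by
    intro a i ξ a' i' η h
    simp only [hJ, sum_inner, inner_sum, inner_smul_left, inner_smul_right,
      orthonormal_iff_ite.1 c.orthonormal]
    simp [h]
  have hTJ : ∀ T ∈ S none, ∃ X : ∀ a, Matrix (Fin (q a)) (Fin (q a)) ℂ,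
      ∀ a i ξ, T (J a i ξ) = ∑ i', X a i' i • J a i' ξ := by
    intro T hT
    obtain ⟨X, hX⟩ := hX T hT
    refine ⟨X, fun a i ξ => ?_⟩
    simp only [hJ, map_sum, map_smul, hX, Finset.smul_sum]
    rw [Finset.sum_comm]
    exact Finset.sum_congr rfl fun _ _ => Finset.sum_congr rfl fun _ _ => smul_comm _ _ _
  let i₀ : ∀ a, Fin (q a) := fun a => ⟨0, hq a⟩
  have hJJ : ∀ a, LinearMap.adjoint (J a (i₀ a)) ∘ₗ J a (i₀ a) = LinearMap.id := by
    intro a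
    ext1 ξ
    refine ext_inner_left ℂ fun η => ?_
    rw [LinearMap.comp_apply, LinearMap.adjoint_inner_right, hJin, if_pos rfl]
    rfl
  -- Compression to the single slot `i₀`. For `B` in the centralizer it describes the action in
  -- every slot (`hR`), so it is multiplicative there; being a compression, it respects adjoints.
  let R : ∀ a, Module.End ℂ H → Module.End ℂ (EuclideanSpace ℂ (Fin (p a))) := fun a B =>
    LinearMap.adjoint (J a (i₀ a)) ∘ₗ B ∘ₗ J a (i₀ a)
  have hR : ∀ B ∈ Set.centralizer (S none), ∀ a i ξ, B (J a i ξ) = J a i (R a B ξ) := by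
    intro B hB a
    obtain ⟨Y, hY⟩ := hY B hB
    have h1 : ∀ i ξ, B (J a i ξ) = J a i (Matrix.toEuclideanLin (Y a) ξ) := by
      intro i ξ
      simp only [hJ, map_sum, map_smul, hY, Finset.smul_sum]
      rw [Finset.sum_comm]
      refine Finset.sum_congr rfl fun f' _ => ?_
      rw [Matrix.toLpLin_apply]
      simp only [Matrix.mulVec, dotProduct, Finset.sum_smul, mul_smul]
      exact Finset.sum_congr rfl fun f _ => smul_comm _ _ _
    have h2 : R a B = Matrix.toEuclideanLin (Y a) := by
      have : B ∘ₗ J a (i₀ a) = J a (i₀ a) ∘ₗ Matrix.toEuclideanLin (Y a) :=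
        LinearMap.ext (h1 _)
      simp only [R]
      rw [this, ← LinearMap.comp_assoc, hJJ, LinearMap.id_comp]
    intro i ξ
    rw [h2, h1]
  have hmem : ∀ k, ∀ B ∈ S (some k), B ∈ Set.centralizer (S none) := fun k B hB T hT =>
    hcomm none (some k) (by simp) T hT B hB
  have hRmul : ∀ B ∈ Set.centralizer (S none), ∀ B' ∈ Set.centralizer (S none), ∀ a,
      R a (B * B') = R a B * R a B' := by
    intro B hB B' hB' a
    refine LinearMap.ext fun ξ => ?_
    have : R a (B * B') ξ = LinearMap.adjoint (J a (i₀ a)) (B (B' (J a (i₀ a) ξ))) := rfl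
    rw [this, hR B' hB', hR B hB]
    exact LinearMap.congr_fun (hJJ a) _
  have hex : ∀ a, HasTensorBasis fun k => R a '' S (some k) := by
    intro a
    refine ih (p a) (hp a) _ ?_ ?_
    · rintro k _ ⟨B, hB, rfl⟩
      refine ⟨LinearMap.adjoint B, hS _ B hB, ?_⟩
      simp only [R, LinearMap.adjoint_comp, LinearMap.adjoint_adjoint, LinearMap.comp_assoc]
    · rintro k l hkl _ ⟨B, hB, rfl⟩ _ ⟨B', hB', rfl⟩
      rw [← hRmul _ (hmem k B hB) _ (hmem l B' hB'), ← hRmul _ (hmem l B' hB') _ (hmem k B hB),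
        hcomm (some k) (some l) (by simpa using hkl) B hB B' hB']
  choose r' p' q' b hp' hq' hb using hex
  -- The refined basis: the tensor basis of each multiplicity space, placed in every slot. The pairs
  -- `(a, β)` become the new blocks.
  let v : (Σ a, (Σ β, Fin (p' a β) × ∀ k, Fin (q' a β k)) × Fin (q a)) → H := fun x =>
    J x.1 x.2.2 (b x.1 x.2.1)
  have hv : Orthonormal ℂ v := by
    classical
    rw [orthonormal_iff_ite]
    rintro ⟨a, x, i⟩ ⟨a', x', i'⟩
    by_cases h : a = a'
    · subst h
      simp only [v, hJin, orthonormal_iff_ite.1 (b a).orthonormal]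
      by_cases hi : i = i' <;> by_cases hx : x = x' <;> simp [hi, hx]
    · simp [v, hJne _ _ _ _ _ _ h, h]
  have hvspan : ⊤ ≤ Submodule.span ℂ (Set.range v) := by
    rw [← c.toBasis.span_eq, Submodule.span_le]
    rintro _ ⟨⟨a, f, i⟩, rfl⟩
    have h1 : c.toBasis ⟨a, f, i⟩ = J a i (EuclideanSpace.single f 1) := by
      simp [hJ]
    rw [h1, ← (b a).sum_repr (EuclideanSpace.single f 1), map_sum]
    refine Submodule.sum_mem _ fun x _ => ?_
    rw [map_smul]
    exact Submodule.smul_mem _ _ (Submodule.subset_span ⟨⟨a, x, i⟩, rfl⟩)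
  let Q : (Σ a, Fin (r' a)) → Option K → ℕ := fun x o => o.elim (q x.1) (q' x.1 x.2)
  let E : (Σ a, (Σ β, Fin (p' a β) × ∀ k, Fin (q' a β k)) × Fin (q a)) ≃
      Σ x : Σ a, Fin (r' a), Fin (p' x.1 x.2) × ∀ o, Fin (Q x o) :=
    { toFun := fun x => ⟨⟨x.1, x.2.1.1⟩, x.2.1.2.1, fun o =>
        match o with
        | none => x.2.2
        | some k => x.2.1.2.2 k⟩
      invFun := fun y => ⟨y.1.1, ⟨y.1.2, y.2.1, fun k => y.2.2 (some k)⟩, y.2.2 none⟩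
      left_inv := fun _ => rfl
      right_inv := by
        rintro ⟨⟨a, β⟩, f, s⟩
        refine congrArg (fun s => (⟨⟨a, β⟩, f, s⟩ :
          Σ x : Σ a, Fin (r' a), Fin (p' x.1 x.2) × ∀ o, Fin (Q x o))) ?_
        funext o
        cases o <;> rfl }
  let b' := (OrthonormalBasis.mk hv hvspan).reindex E
  have hb' : ∀ x f s, b' ⟨x, f, s⟩ =
      J x.1 (s none) (b x.1 ⟨x.2, f, fun k => s (some k)⟩) := by
    intro x f s
    simp only [b', OrthonormalBasis.reindex_apply, OrthonormalBasis.coe_mk]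
    rfl
  refine HasTensorBasis.of_basis (Equiv.refl _) b' (fun x => hp' _ _) ?_ ?_
  · rintro x (_ | k)
    · exact hq _
    · exact hq' _ _ k
  · rintro (_ | k) T hT
    · obtain ⟨X, hX⟩ := hTJ T hT
      refine ⟨fun x => X x.1, fun x f s => ?_⟩
      refine (congrArg T (hb' x f s)).trans ((hX x.1 (s none) _).trans
        (Finset.sum_congr rfl fun t _ => congrArg (X x.1 t (s none) • ·) ?_))
      exact ((hb' x f (Function.update s none t)).trans
        (congrArg₂ (fun i s' => J x.1 i (b x.1 ⟨x.2, f, s'⟩)) (Function.update_self _ _ _)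
          (funext fun k => Function.update_of_ne (by simp) _ _))).symm
    · choose m hm using fun a => hb a k _ ⟨T, hT, rfl⟩
      refine ⟨fun x => m x.1 x.2, fun x f s => ?_⟩
      have hu : ∀ t, (fun l => Function.update s (some k) t (some l)) =
          Function.update (fun l => s (some l)) k t := by
        intro t
        funext l
        by_cases h : l = k
        · subst h
          simp
        · rw [Function.update_of_ne h, Function.update_of_ne (by simpa using h)]
      refine (congrArg T (hb' x f s)).trans ((hR T (hmem k T hT) _ _ _).trans
        ((congrArg (J x.1 (s none)) (hm x.1 x.2 f _)).trans ?_))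
      rw [map_sum]
      refine Finset.sum_congr rfl fun t _ => (map_smul _ _ _).trans
        (congrArg (m x.1 x.2 t (s (some k)) • ·) ?_)
      exact ((hb' x f (Function.update s (some k) t)).trans
        (congrArg₂ (fun i s' => J x.1 i (b x.1 ⟨x.2, f, s'⟩))
          (Function.update_of_ne (by simp) _ _) (hu t))).symm

/-- Finitely many pairwise commuting adjoint-closed sets of operators act on different factors of a
tensor product structure, after an orthogonal decomposition of the Hilbert space. -/
theorem exists_tensorBasis (K : Type) [Fintype K] [DecidableEq K] {n : ℕ} (hn : 0 < n)
    (S : K → Set (Module.End ℂ (EuclideanSpace ℂ (Fin n)))) (hS : ∀ k, AdjointClosed (S k))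
    (hcomm : ∀ k l, k ≠ l → ∀ T ∈ S k, ∀ T' ∈ S l, T * T' = T' * T) :
    HasTensorBasis S := by
  -- The statement is generalized over the dimension, which changes in the recursion, and over the
  -- decidability instance, which the induction over finite types does not fix.
  suffices h : ∀ [DecidableEq K] (n : ℕ), 0 < n →
      ∀ S : K → Set (Module.End ℂ (EuclideanSpace ℂ (Fin n))), (∀ k, AdjointClosed (S k)) →
      (∀ k l, k ≠ l → ∀ T ∈ S k, ∀ T' ∈ S l, T * T' = T' * T) → HasTensorBasis S from
    h n hn S hS hcomm
  refine Fintype.induction_empty_option.{0} (P := fun K _ => ∀ [DecidableEq K] (n : ℕ), 0 < n →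
      ∀ S : K → Set (Module.End ℂ (EuclideanSpace ℂ (Fin n))), (∀ k, AdjointClosed (S k)) →
      (∀ k l, k ≠ l → ∀ T ∈ S k, ∀ T' ∈ S l, T * T' = T' * T) → HasTensorBasis S) ?_ ?_ ?_ K
  · classical
    intro K L _ e ih _ n hn S hS hcomm
    let _ := Fintype.ofEquiv _ e.symm
    obtain ⟨r, p, q, b, hp, hq, hb⟩ := ih n hn (fun k => S (e k)) (fun k => hS _)
      (fun k l hkl => hcomm _ _ (fun h => hkl (e.injective h)))
    refine HasTensorBasis.of_basis e.symm b hp hq fun k T hT => ?_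
    have := hb (e.symm k) T (by simpa using hT)
    exact this
  · intro _ n hn S hS hcomm
    -- No sets to factor: a single block, all of it free.
    let E : Fin n ≃ Σ _ : Unit, Fin n × (∀ k : PEmpty.{1}, Fin 0) :=
      { toFun := fun f => ⟨(), f, fun k => k.elim⟩
        invFun := fun x => x.2.1
        left_inv := fun _ => rfl
        right_inv := by
          rintro ⟨_, f, s⟩
          have : s = fun k => k.elim := funext fun k => k.elim
          rw [this] }
    exact HasTensorBasis.of_basis (p := fun _ : Unit => n) (q := fun _ _ => 0) (Equiv.refl _)
      ((EuclideanSpace.basisFun (Fin n) ℂ).reindex E) (fun _ => hn) (fun _ k => k.elim)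
      fun k => k.elim
  · classical
    intro K _ ih _ n hn S hS hcomm
    exact exists_tensorBasis_option (fun n hn S => ih n hn S) hS hcomm

end TensorBasis

/-! ### Matrix elements of two-particle operators and their one-particle slices. -/

section TwoSite

variable {P : Type} [Fintype P] [DecidableEq P] {κ : P → ℕ}

/-- Only configurations agreeing with `x` away from `p` and `q` contribute, so the sum collapses to
the entries at these two constituents. -/
theorem sum_twoSite_mul {p q : P} (hpq : p ≠ q)
    (h : Matrix (Fin (κ p) × Fin (κ q)) (Fin (κ p) × Fin (κ q)) ℂ) (x : ∀ l, Fin (κ l))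
    (f : (∀ l, Fin (κ l)) → ℂ) :
    ∑ z, twoSite p q h x z * f z =
      ∑ w, h (x p, x q) w * f (Function.update (Function.update x p w.1) q w.2) := by
  symm
  have e1 : ∀ w : Fin (κ p) × Fin (κ q),
      Function.update (Function.update x p w.1) q w.2 p = w.1 := by
    intro w
    rw [Function.update_of_ne hpq, Function.update_self]
  refine Fintype.sum_of_injective
    (fun w => Function.update (Function.update x p w.1) q w.2) ?_ _ _ ?_ ?_
  · intro w w' hw
    refine Prod.ext ?_ ?_
    · exact (e1 w).symm.trans ((congrFun hw p).trans (e1 w'))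
    · simpa using congrFun hw q
  · intro z hz
    rw [twoSite, if_neg, zero_mul]
    intro hl
    refine hz ⟨(z p, z q), funext fun l => ?_⟩
    by_cases h2 : l = q
    · subst h2
      simp
    by_cases h1 : l = p
    · subst h1
      exact e1 _
    · simp [h1, h2, hl l h1 h2]
  · intro w
    rw [twoSite, if_pos, e1, Function.update_self]
    intro l h1 h2
    simp [h1, h2]

theorem twoSite_transpose (p q : P)
    (h : Matrix (Fin (κ p) × Fin (κ q)) (Fin (κ p) × Fin (κ q)) ℂ) :
    (twoSite p q h).transpose = twoSite p q h.transpose := by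
  ext x y
  simp only [Matrix.transpose_apply, twoSite, eq_comm]

theorem sum_mul_twoSite {p q : P} (hpq : p ≠ q)
    (h : Matrix (Fin (κ p) × Fin (κ q)) (Fin (κ p) × Fin (κ q)) ℂ) (x : ∀ l, Fin (κ l))
    (f : (∀ l, Fin (κ l)) → ℂ) :
    ∑ z, f z * twoSite p q h z x =
      ∑ w, f (Function.update (Function.update x p w.1) q w.2) * h w (x p, x q) := by
  have := sum_twoSite_mul hpq h.transpose x f
  simp only [← twoSite_transpose, Matrix.transpose_apply] at this
  simpa only [mul_comm] using this

theorem twoSite_swap (p q : P)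
    (h : Matrix (Fin (κ p) × Fin (κ q)) (Fin (κ p) × Fin (κ q)) ℂ) :
    twoSite p q h = twoSite q p (h.submatrix Prod.swap Prod.swap) := by
  ext x y
  simp only [twoSite, Matrix.submatrix_apply, Prod.swap_prod_mk]
  exact if_congr ⟨fun h l h1 h2 => h l h2 h1, fun h l h1 h2 => h l h2 h1⟩ rfl rfl

/-- The second factor cannot change the index at `q`, nor the first the index at `r`. The
intermediate configuration is thus forced except at the shared constituent `p`. -/
theorem twoSite_mul_twoSite_apply {p q r : P} (hpq : p ≠ q) (hpr : p ≠ r) (hqr : q ≠ r)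
    (h : Matrix (Fin (κ p) × Fin (κ q)) (Fin (κ p) × Fin (κ q)) ℂ)
    (g : Matrix (Fin (κ p) × Fin (κ r)) (Fin (κ p) × Fin (κ r)) ℂ) {z z' : ∀ l, Fin (κ l)}
    (hz : ∀ l, l ≠ p → l ≠ q → l ≠ r → z l = z' l) :
    (twoSite p q h * twoSite p r g) z z' =
      ∑ u, h (z p, z q) (u, z' q) * g (u, z r) (z' p, z' r) := by
  rw [Matrix.mul_apply, sum_twoSite_mul hpq, Fintype.sum_prod_type]
  refine Finset.sum_congr rfl fun u _ => ?_
  rw [Finset.sum_eq_single (z' q)]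
  · rw [twoSite, if_pos]
    · simp [hpq, hqr.symm, hpr.symm]
    · intro l h1 h2
      by_cases h3 : l = q
      · subst h3
        simp
      · simp [h1, h3, hz l h1 h3 h2]
  · intro c _ hc
    rw [twoSite, if_neg, mul_zero]
    intro hl
    have := hl q hpq.symm hqr
    rw [Function.update_self] at this
    exact hc this
  · intro h
    exact absurd (Finset.mem_univ _) h

/-- The matrix element of `X` between `|x⟩` and `|y⟩` on all constituents except `p`: an operator
on the constituent `p`. -/
def slice (p : P) (X : Op κ) (x y : ∀ l, Fin (κ l)) : Matrix (Fin (κ p)) (Fin (κ p)) ℂ :=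
  fun u v => X (Function.update x p u) (Function.update y p v)

theorem slice_twoSite {p q : P} (hpq : p ≠ q)
    (h : Matrix (Fin (κ p) × Fin (κ q)) (Fin (κ p) × Fin (κ q)) ℂ) (x y : ∀ l, Fin (κ l)) :
    slice p (twoSite p q h) x y =
      if ∀ l, l ≠ p → l ≠ q → x l = y l then Matrix.of fun u v => h (u, x q) (v, y q) else 0 := by
  ext u v
  have : (∀ l, l ≠ p → l ≠ q → Function.update x p u l = Function.update y p v l) ↔
      ∀ l, l ≠ p → l ≠ q → x l = y l := by
    refine forall_congr' fun l => forall_congr' fun h1 => ?_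
    simp [h1]
  simp only [slice, twoSite, this, Function.update_self, Function.update_of_ne hpq.symm]
  split_ifs <;> rfl

/-- With the indices at `q` and `r` prescribed, each entry of a product of slices is an entry of the
product of the full operators, so commutation passes to slices. -/
theorem slice_mul_slice_comm {p q r : P} (hpq : p ≠ q) (hpr : p ≠ r) (hqr : q ≠ r)
    {h : Matrix (Fin (κ p) × Fin (κ q)) (Fin (κ p) × Fin (κ q)) ℂ}
    {g : Matrix (Fin (κ p) × Fin (κ r)) (Fin (κ p) × Fin (κ r)) ℂ}
    (hc : Commute (twoSite p q h) (twoSite p r g)) (x y x' y' : ∀ l, Fin (κ l)) :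
    slice p (twoSite p q h) x y * slice p (twoSite p r g) x' y' =
      slice p (twoSite p r g) x' y' * slice p (twoSite p q h) x y := by
  rw [slice_twoSite hpq, slice_twoSite hpr]
  split_ifs with h1 h2
  · ext u v
    -- Indices at `q` come from the first pair of configurations, those at `r` from the second.
    let z := Function.update (Function.update (Function.update x p u) q (x q)) r (x' r)
    let z' := Function.update (Function.update (Function.update x p v) q (y q)) r (y' r)
    have hz : ∀ l, l ≠ p → l ≠ q → l ≠ r → z l = z' l := by
      intro l h1 h2 h3
      simp [z, z', h1, h2, h3]
    have e1 := twoSite_mul_twoSite_apply hpq hpr hqr h g hz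
    have e2 := twoSite_mul_twoSite_apply hpr hpq hqr.symm g h
      (fun l h1 h2 h3 => hz l h1 h3 h2)
    rw [hc.eq, e2] at e1
    simpa [z, z', hpq, hpr, hqr, Matrix.mul_apply] using e1.symm
  all_goals simp

end TwoSite

/-! ### From slices acting on single factors to an operator acting on a pair of factors. -/

section Pair

theorem toEuclideanLin_apply_apply {m n : Type*} [Fintype m] [Fintype n] [DecidableEq n]
    (M : Matrix m n ℂ) (v : EuclideanSpace ℂ n) (i : m) :
    Matrix.toEuclideanLin M v i = ∑ j, M i j * v j :=
  rfl

/-- If the slices of a two-particle operator `h` act only on one tensor factor of each particle,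
then `h` acts only on the product of these two factors. -/
theorem exists_pairOp {K L A B : Type} [DecidableEq K] [Fintype K] [DecidableEq L] [Fintype L]
    {p : A → ℕ} {q : A → K → ℕ} {p' : B → ℕ}
    {q' : B → L → ℕ} {d d' : ℕ}
    {b : (Σ a, Fin (p a) × ∀ k, Fin (q a k)) → EuclideanSpace ℂ (Fin d)} (hb : Orthonormal ℂ b)
    (hp : ∀ a, 0 < p a) (hq : ∀ a k, 0 < q a k)
    (c : (Σ a, Fin (p' a) × ∀ k, Fin (q' a k)) → EuclideanSpace ℂ (Fin d')) (k : K) (l : L)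
    (h : Matrix (Fin d × Fin d') (Fin d × Fin d') ℂ)
    (h1 : ∀ w w', ActsOn b k
      (Matrix.toEuclideanLin (Matrix.of fun u u' => h (u, w) (u', w'))))
    (h2 : ∀ u u', ActsOn c l
      (Matrix.toEuclideanLin (Matrix.of fun w w' => h (u, w) (u', w')))) :
    ∃ g : ∀ a a', Matrix (Fin (q a k) × Fin (q' a' l)) (Fin (q a k) × Fin (q' a' l)) ℂ,
      ∀ a f s a' f' s' x, ∑ y, h x y * (b ⟨a, f, s⟩ y.1 * c ⟨a', f', s'⟩ y.2) =
        ∑ t, b ⟨a, f, Function.update s k t.1⟩ x.1 * c ⟨a', f', Function.update s' l t.2⟩ x.2 *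
          g a a' t (s k, s' l) := by
  classical
  choose m hm using h1
  choose m' hm' using h2
  have hm1 : ∀ w w' a f s u, ∑ u', h (u, w) (u', w') * b ⟨a, f, s⟩ u' =
      ∑ t, m w w' a t (s k) * b ⟨a, f, Function.update s k t⟩ u := by
    intro w w' a f s u
    have := congrArg (fun v : EuclideanSpace ℂ (Fin d) => v u) (hm w w' a f s)
    simpa [toEuclideanLin_apply_apply] using this
  have hm2 : ∀ u u' a f s w, ∑ w', h (u, w) (u', w') * c ⟨a, f, s⟩ w' =
      ∑ t, m' u u' a t (s l) * c ⟨a, f, Function.update s l t⟩ w := by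
    intro u u' a f s w
    have := congrArg (fun v : EuclideanSpace ℂ (Fin d') => v w) (hm' u u' a f s)
    simpa [toEuclideanLin_apply_apply] using this
  -- Reference vectors, with free index and all factor indices other than `k` set to `0`. The
  -- matrices `m` do not depend on those indices, so they can be computed from `β`.
  let β : ∀ a, Fin (q a k) → EuclideanSpace ℂ (Fin d) := fun a t =>
    b ⟨a, ⟨0, hp a⟩, Function.update (fun k => ⟨0, hq a k⟩) k t⟩
  have hβ : ∀ a t t', ∑ u, (starRingEnd ℂ) (β a t u) * β a t' u = if t = t' then 1 else 0 := by
    intro a t t'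
    have := orthonormal_iff_ite.1 hb
      ⟨a, ⟨0, hp a⟩, Function.update (fun k => ⟨0, hq a k⟩) k t⟩
      ⟨a, ⟨0, hp a⟩, Function.update (fun k => ⟨0, hq a k⟩) k t'⟩
    simp only [PiLp.inner_apply, RCLike.inner_apply] at this
    simp only [β, mul_comm]
    rw [this]
    have hinj := Function.update_injective (fun k => (⟨0, hq a k⟩ : Fin (q a k))) k
    simp [hinj.eq_iff]
  -- This expresses `m w w'` linearly through the entries of `h`, with coefficients independent of
  -- `w, w'`; the hypothesis on the second particle can then be applied under the sum.
  have hme : ∀ w w' a t t', m w w' a t t' =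
      ∑ u, ∑ u', (starRingEnd ℂ) (β a t u) * β a t' u' * h (u, w) (u', w') := by
    intro w w' a t t'
    have e : ∀ u, ∑ u', h (u, w) (u', w') * β a t' u' = ∑ t₁, m w w' a t₁ t' * β a t₁ u := by
      intro u
      have := hm1 w w' a ⟨0, hp a⟩ (Function.update (fun k => ⟨0, hq a k⟩) k t') u
      simpa [β] using this
    calc m w w' a t t' = ∑ t₁, m w w' a t₁ t' * ∑ u, (starRingEnd ℂ) (β a t u) * β a t₁ u := by
          simp [hβ]
      _ = ∑ u, (starRingEnd ℂ) (β a t u) * ∑ t₁, m w w' a t₁ t' * β a t₁ u := by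
          simp only [Finset.mul_sum]
          rw [Finset.sum_comm]
          exact Finset.sum_congr rfl fun _ _ => Finset.sum_congr rfl fun _ _ => by ring
      _ = _ := by
          simp only [← e, Finset.mul_sum]
          exact Finset.sum_congr rfl fun _ _ => Finset.sum_congr rfl fun _ _ => by ring
  refine ⟨fun a a' t s => ∑ u, ∑ u', (starRingEnd ℂ) (β a t.1 u) * β a s.1 u' *
    m' u u' a' t.2 s.2, ?_⟩
  rintro a f s a' f' s' ⟨x, w⟩
  have e2 : ∀ t t', ∑ w', m w w' a t t' * c ⟨a', f', s'⟩ w' =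
      ∑ t₂, (∑ u, ∑ u', (starRingEnd ℂ) (β a t u) * β a t' u' * m' u u' a' t₂ (s' l)) *
        c ⟨a', f', Function.update s' l t₂⟩ w := by
    intro t t'
    calc ∑ w', m w w' a t t' * c ⟨a', f', s'⟩ w'
        = ∑ u, ∑ u', (starRingEnd ℂ) (β a t u) * β a t' u' *
            ∑ w', h (u, w) (u', w') * c ⟨a', f', s'⟩ w' := by
          simp only [hme, Finset.sum_mul, Finset.mul_sum]
          rw [Finset.sum_comm]
          refine Finset.sum_congr rfl fun _ _ => ?_
          rw [Finset.sum_comm]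
          exact Finset.sum_congr rfl fun _ _ => Finset.sum_congr rfl fun _ _ => by ring
      _ = _ := by
          simp only [hm2, Finset.sum_mul, Finset.mul_sum]
          symm
          rw [Finset.sum_comm]
          refine Finset.sum_congr rfl fun _ _ => ?_
          rw [Finset.sum_comm]
          exact Finset.sum_congr rfl fun _ _ => Finset.sum_congr rfl fun _ _ => by ring
  calc ∑ y : Fin d × Fin d', h (x, w) y * (b ⟨a, f, s⟩ y.1 * c ⟨a', f', s'⟩ y.2)
      = ∑ w', (∑ u', h (x, w) (u', w') * b ⟨a, f, s⟩ u') * c ⟨a', f', s'⟩ w' := by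
        rw [Fintype.sum_prod_type_right]
        simp only [Finset.sum_mul]
        exact Finset.sum_congr rfl fun _ _ => Finset.sum_congr rfl fun _ _ => by ring
    _ = ∑ t, b ⟨a, f, Function.update s k t⟩ x *
          ∑ w', m w w' a t (s k) * c ⟨a', f', s'⟩ w' := by
        simp only [hm1, Finset.sum_mul, Finset.mul_sum]
        rw [Finset.sum_comm]
        exact Finset.sum_congr rfl fun _ _ => Finset.sum_congr rfl fun _ _ => by ring
    _ = _ := by
        simp only [e2]
        rw [Fintype.sum_prod_type]
        refine Finset.sum_congr rfl fun _ _ => ?_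
        rw [Finset.mul_sum]
        exact Finset.sum_congr rfl fun _ _ => by ring

end Pair

/-! ### Projectors act on pairs of subparticles. -/

section Localize

variable {n : ℕ} {G : SimpleGraph (Fin n)} [DecidableRel G.Adj] {d : Fin n → ℕ}

theorem prod_eq_mul_mul_prod_erase {j k : Fin n} (hjk : j ≠ k) (F : Fin n → ℂ) :
    ∏ l, F l = F j * F k * ∏ l ∈ (Finset.univ.erase j).erase k, F l := by
  rw [mul_assoc, Finset.mul_prod_erase _ _ (by simp [hjk.symm]),
    Finset.mul_prod_erase _ _ (Finset.mem_univ _)]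

/-- The indices of the subparticles of the particle `j` in the product basis vector `|y⟩` of
`ℋ^{(α)}`. -/
def Partition.subIndex (D : Partition G d) (α : D.Label) (y : ∀ s, Fin (D.fineDim α s))
    (j : Fin n) (k : G.neighborSet j) : Fin (D.subDim j (α j) k) :=
  y (.inr ⟨(j, k), k.2⟩)

/-- The index of the basis vector of `ℋ_j` in the product basis vector `|y⟩` of `ℋ^{(α)}`. -/
def Partition.siteIndex (D : Partition G d) (α : D.Label) (y : ∀ s, Fin (D.fineDim α s))
    (j : Fin n) : Σ a : Fin (D.numBlocks j),
      Fin (D.freeDim j a) × ∀ k : G.neighborSet j, Fin (D.subDim j a k) :=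
  ⟨α j, y (.inl j), D.subIndex α y j⟩

theorem Partition.incl_apply (D : Partition G d) (α : D.Label) (x : ∀ j, Fin (d j))
    (y : ∀ s, Fin (D.fineDim α s)) :
    D.incl α x y = ∏ j, D.basis j (D.siteIndex α y j) (x j) :=
  rfl

theorem Partition.subIndex_update (D : Partition G d) (α : D.Label)
    (y : ∀ s, Fin (D.fineDim α s)) (a : G.Dart) (t : Fin (D.fineDim α (.inr a))) :
    D.subIndex α (Function.update y (.inr a) t) a.fst =
      Function.update (D.subIndex α y a.fst) ⟨a.snd, a.adj⟩ t := by
  funext k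
  by_cases hk : k = ⟨a.snd, a.adj⟩
  · subst hk
    have h : Function.update (D.subIndex α y a.fst) ⟨a.snd, a.adj⟩ t ⟨a.snd, a.adj⟩ = t :=
      Function.update_self _ _ _
    rw [h]
    exact Function.update_self (Sum.inr a) t y
  · have h : Function.update (D.subIndex α y a.fst) ⟨a.snd, a.adj⟩ t k = D.subIndex α y a.fst k :=
      Function.update_of_ne hk _ _
    rw [h]
    refine Function.update_of_ne (fun h => hk (Subtype.ext ?_)) _ _
    exact congrArg (fun b : G.Dart => b.snd) (Sum.inr.inj h)

theorem Partition.subIndex_update_of_ne (D : Partition G d) (α : D.Label)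
    (y : ∀ s, Fin (D.fineDim α s)) (a : G.Dart) (t : Fin (D.fineDim α (.inr a))) {j : Fin n}
    (hj : a.fst ≠ j) : D.subIndex α (Function.update y (.inr a) t) j = D.subIndex α y j := by
  funext k
  refine Function.update_of_ne (fun h => hj ?_) _ _
  exact (congrArg (fun b : G.Dart => b.fst) (Sum.inr.inj h)).symm

theorem Partition.siteIndex_update (D : Partition G d) (α : D.Label)
    (y : ∀ s, Fin (D.fineDim α s)) (a : G.Dart) (t : Fin (D.fineDim α (.inr a))) :
    D.siteIndex α (Function.update y (.inr a) t) a.fst =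
      ⟨α a.fst, y (.inl a.fst), Function.update (D.subIndex α y a.fst) ⟨a.snd, a.adj⟩ t⟩ :=
  congrArg (fun s => (⟨α a.fst, y (.inl a.fst), s⟩ : Σ b : Fin (D.numBlocks a.fst),
    Fin (D.freeDim a.fst b) × ∀ k : G.neighborSet a.fst, Fin (D.subDim a.fst b k)))
    (D.subIndex_update α y a t)

theorem Partition.siteIndex_update_of_ne (D : Partition G d) (α : D.Label)
    (y : ∀ s, Fin (D.fineDim α s)) (a : G.Dart) (t : Fin (D.fineDim α (.inr a))) {j : Fin n}
    (hj : a.fst ≠ j) : D.siteIndex α (Function.update y (.inr a) t) j = D.siteIndex α y j :=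
  congrArg (fun s => (⟨α j, y (.inl j), s⟩ : Σ b : Fin (D.numBlocks j),
    Fin (D.freeDim j b) × ∀ k : G.neighborSet j, Fin (D.subDim j b k)))
    (D.subIndex_update_of_ne α y a t hj)

/-- If the one-particle slices of each projector act only on the corresponding subparticles, then
the projectors act only on pairs of subparticles. -/
theorem exists_localizes (D : Partition G d) (x : Problem G d) (hd : ∀ j, 0 < d j)
    (hD : ∀ j (k : G.neighborSet j), ∀ e : Edge G, e.1.edge = s(j, (k : Fin n)) → ∀ y z,
      ActsOn (D.basis j) k (Matrix.toEuclideanLin (slice j (x.proj e) y z))) :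
    ∃ h : D.PairOps, D.Localizes h x := by
  choose H hH using x.twoLocal
  -- An arbitrary background: a slice of `Π_{jk}` at `j` depends on it only through the entry at
  -- `k`, apart from requiring both configurations to agree elsewhere.
  let o : ∀ l, Fin (d l) := fun l => ⟨0, hd l⟩
  have hne : ∀ e : Edge G, e.1.fst ≠ e.1.snd := fun e => ne_of_lt e.2
  have key := fun e : Edge G => exists_pairOp (D.basis e.1.fst).orthonormal
    (D.freeDim_pos _) (D.subDim_pos _) (D.basis e.1.snd) ⟨e.1.snd, e.1.adj⟩
    ⟨e.1.fst, e.1.adj.symm⟩ (H e) (by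
      intro w w'
      have := hD e.1.fst ⟨e.1.snd, e.1.adj⟩ e rfl (Function.update o e.1.snd w)
        (Function.update o e.1.snd w')
      rw [hH, slice_twoSite (hne e), if_pos (fun l h1 h2 => by simp [h2])] at this
      simpa using this) (by
      intro u u'
      have := hD e.1.snd ⟨e.1.fst, e.1.adj.symm⟩ e Sym2.eq_swap (Function.update o e.1.fst u)
        (Function.update o e.1.fst u')
      rw [hH, twoSite_swap, slice_twoSite (hne e).symm,
        if_pos (fun l h1 h2 => by simp [h2])] at this
      simpa using this)
  choose g hg using key
  refine ⟨g, fun e α => ?_⟩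
  ext z y
  rw [Matrix.mul_apply, Matrix.mul_apply, hH, sum_twoSite_mul (hne e)]
  refine Eq.trans ?_ (sum_mul_twoSite (κ := D.fineDim α) (P := Fin n ⊕ G.Dart)
    (p := .inr e.1) (q := .inr e.1.symm) (by simpa using e.1.symm_ne.symm) _ y
    (fun w => D.incl α z w)).symm
  -- The amplitude of the spectator particles, a common factor of both sides.
  let R : ℂ := ∏ l ∈ (Finset.univ.erase e.1.fst).erase e.1.snd,
    D.basis l (D.siteIndex α y l) (z l)
  have hL : ∀ w : Fin (d e.1.fst) × Fin (d e.1.snd),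
      D.incl α (Function.update (Function.update z e.1.fst w.1) e.1.snd w.2) y =
        D.basis e.1.fst (D.siteIndex α y e.1.fst) w.1 *
          D.basis e.1.snd (D.siteIndex α y e.1.snd) w.2 * R := by
    intro w
    rw [D.incl_apply, prod_eq_mul_mul_prod_erase (hne e), Function.update_self,
      Function.update_of_ne (hne e), Function.update_self]
    refine congrArg _ (Finset.prod_congr rfl fun l hl => ?_)
    simp only [Finset.mem_erase, Finset.mem_univ, and_true] at hl
    rw [Function.update_of_ne hl.1, Function.update_of_ne hl.2]
  have hR : ∀ t : Fin (D.fineDim α (.inr e.1)) × Fin (D.fineDim α (.inr e.1.symm)),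
      D.incl α z (Function.update (Function.update y (.inr e.1) t.1) (.inr e.1.symm) t.2) =
        D.basis e.1.fst ⟨α e.1.fst, y (.inl e.1.fst), Function.update
            (fun k => y (.inr ⟨(e.1.fst, k), k.2⟩)) ⟨e.1.snd, e.1.adj⟩ t.1⟩ (z e.1.fst) *
          D.basis e.1.snd ⟨α e.1.snd, y (.inl e.1.snd), Function.update
            (fun k => y (.inr ⟨(e.1.snd, k), k.2⟩)) ⟨e.1.fst, e.1.adj.symm⟩ t.2⟩
            (z e.1.snd) * R := by
    intro t
    rw [D.incl_apply, prod_eq_mul_mul_prod_erase (hne e)]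
    refine congrArg₂ _ (congrArg₂ _ ?_ ?_) (Finset.prod_congr rfl fun l hl => ?_)
    · rw [D.siteIndex_update_of_ne α _ e.1.symm t.2 (hne e).symm]
      exact congrArg (D.basis e.1.fst · (z e.1.fst)) (D.siteIndex_update α y e.1 t.1)
    · refine congrArg (D.basis e.1.snd · (z e.1.snd))
        ((D.siteIndex_update α (Function.update y (.inr e.1) t.1) e.1.symm t.2).trans ?_)
      rw [D.subIndex_update_of_ne α y e.1 t.1 (j := e.1.symm.fst) (hne e)]
      rfl
    · simp only [Finset.mem_erase, Finset.mem_univ, and_true] at hl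
      rw [D.siteIndex_update_of_ne α _ e.1.symm t.2 (Ne.symm hl.1),
        D.siteIndex_update_of_ne α _ e.1 t.1 (Ne.symm hl.2)]
  simp only [hL, hR]
  have := hg e (α e.1.fst) (y (.inl e.1.fst)) (fun k => y (.inr ⟨(e.1.fst, k), k.2⟩))
    (α e.1.snd) (y (.inl e.1.snd)) (fun k => y (.inr ⟨(e.1.snd, k), k.2⟩))
    (z e.1.fst, z e.1.snd)
  have this' := congrArg (· * R) this
  simp only [Finset.sum_mul] at this'
  refine Eq.trans ?_ (this'.trans ?_)
  · refine Finset.sum_congr rfl fun w _ => ?_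
    exact (mul_assoc _ _ _).symm
  · refine Finset.sum_congr rfl fun w _ => ?_
    exact mul_right_comm _ _ _

end Localize

/-! ### Algebra of one- and two-site operators. -/

section TwoSiteAlgebra

variable {P : Type} [Fintype P] [DecidableEq P] {κ : P → ℕ}

theorem twoSite_mul {p q : P} (hpq : p ≠ q)
    (h g : Matrix (Fin (κ p) × Fin (κ q)) (Fin (κ p) × Fin (κ q)) ℂ) :
    twoSite p q h * twoSite p q g = twoSite p q (h * g) := by
  ext x y
  rw [Matrix.mul_apply, sum_twoSite_mul hpq]
  have : ∀ w : Fin (κ p) × Fin (κ q),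
      twoSite p q g (Function.update (Function.update x p w.1) q w.2) y =
        if ∀ l, l ≠ p → l ≠ q → x l = y l then g w (y p, y q) else 0 := by
    intro w
    rw [twoSite]
    refine if_congr (forall_congr' fun l => forall_congr' fun h1 => forall_congr' fun h2 => ?_)
      ?_ rfl
    · rw [Function.update_of_ne h2, Function.update_of_ne h1]
    · rw [Function.update_self, Function.update_of_ne hpq, Function.update_self]
  simp only [this]
  simp only [twoSite]
  split_ifs
  · rw [Matrix.mul_apply]
  · simp

/-- Positive dimensions supply a background configuration at which the entries of `h` can be read
off. -/
theorem twoSite_injective {p q : P} (hpq : p ≠ q) (hκ : ∀ l, 0 < κ l) :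
    Function.Injective (twoSite (κ := κ) p q) := by
  intro h g hg
  ext u v
  let z : Fin (κ p) × Fin (κ q) → ∀ l, Fin (κ l) := fun u =>
    Function.update (Function.update (fun l => ⟨0, hκ l⟩) p u.1) q u.2
  have hz : ∀ u v : Fin (κ p) × Fin (κ q), ∀ l, l ≠ p → l ≠ q → z u l = z v l := by
    intro u v l h1 h2
    simp [z, h1, h2]
  have := congrFun (congrFun hg (z u)) (z v)
  rw [twoSite, twoSite, if_pos (hz u v), if_pos (hz u v)] at this
  simpa [z, hpq] using this

theorem sum_oneSite_mul (p : P) (O : Matrix (Fin (κ p)) (Fin (κ p)) ℂ) (x : ∀ l, Fin (κ l))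
    (f : (∀ l, Fin (κ l)) → ℂ) :
    ∑ z, oneSite p O x z * f z = ∑ u, O (x p) u * f (Function.update x p u) := by
  symm
  refine Fintype.sum_of_injective (fun u => Function.update x p u)
    (Function.update_injective x p) _ _ ?_ ?_
  · intro z hz
    rw [oneSite, if_neg, zero_mul]
    intro hl
    refine hz ⟨z p, funext fun l => ?_⟩
    by_cases h1 : l = p
    · subst h1
      simp
    · simp [h1, hl l h1]
  · intro u
    rw [oneSite, if_pos, Function.update_self]
    intro l h1
    simp [h1]

theorem toEuclideanLin_mul_apply {l m n : Type*} [Fintype l] [Fintype m] [Fintype n]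
    [DecidableEq m] [DecidableEq n] (A : Matrix l m ℂ) (B : Matrix m n ℂ)
    (v : EuclideanSpace ℂ n) :
    Matrix.toEuclideanLin (A * B) v = Matrix.toEuclideanLin A (Matrix.toEuclideanLin B v) := by
  simp

theorem toEuclideanLin_one_apply {n : Type*} [Fintype n] [DecidableEq n]
    (v : EuclideanSpace ℂ n) : Matrix.toEuclideanLin (1 : Matrix n n ℂ) v = v := by
  simp

end TwoSiteAlgebra

theorem Edge.inr_ne_inr_symm {n : ℕ} {G : SimpleGraph (Fin n)} (e : Edge G) :
    (Sum.inr e.1 : Fin n ⊕ G.Dart) ≠ Sum.inr e.1.symm := by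
  simpa using e.1.symm_ne.symm

theorem Edge.coe_ne_symm {n : ℕ} {G : SimpleGraph (Fin n)} (e e' : Edge G) : e.1 ≠ e'.1.symm := by
  intro h
  have h1 : e.1.fst = e'.1.snd := congrArg (fun a : G.Dart => a.fst) h
  have h2 : e.1.snd = e'.1.fst := congrArg (fun a : G.Dart => a.snd) h
  have h3 := e.2
  rw [h1, h2] at h3
  exact lt_asymm h3 e'.2

variable {n : ℕ} {G : SimpleGraph (Fin n)} [DecidableRel G.Adj] {d : Fin n → ℕ}

/-! ### The blocks as an orthogonal resolution of the identity, and product vectors. -/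

namespace Partition

theorem fineDim_pos (D : Partition G d) (α : D.Label) : ∀ s, 0 < D.fineDim α s
  | .inl j => D.freeDim_pos j _
  | .inr _ => D.subDim_pos _ _ _

theorem siteIndex_injective (D : Partition G d) : Function.Injective
    fun z : Σ α : D.Label, ∀ s, Fin (D.fineDim α s) => D.siteIndex z.1 z.2 := by
  rintro ⟨α, y⟩ ⟨β, z⟩ h
  have hj : ∀ j, D.siteIndex α y j = D.siteIndex β z j := congrFun h
  obtain rfl : α = β := funext fun j => congrArg Sigma.fst (hj j)
  refine congrArg (Sigma.mk α) (funext fun s => ?_)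
  have hj' : ∀ j, (y (.inl j), D.subIndex α y j) = (z (.inl j), D.subIndex α z j) := fun j =>
    eq_of_heq (Sigma.mk.inj_iff.1 (hj j)).2
  rcases s with j | a
  · exact congrArg Prod.fst (hj' j)
  · exact congrFun (congrArg Prod.snd (hj' a.fst)) ⟨a.snd, a.adj⟩

theorem siteIndex_surjective (D : Partition G d) : Function.Surjective
    fun z : Σ α : D.Label, ∀ s, Fin (D.fineDim α s) => D.siteIndex z.1 z.2 := by
  intro i
  refine ⟨⟨fun j => (i j).1, fun s => match s with
    | .inl j => (i j).2.1
    | .inr a => (i a.fst).2.2 ⟨a.snd, a.adj⟩⟩, rfl⟩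

/-- The inner product of two product vectors factors over the particles, where orthonormality of the
adapted bases applies. -/
theorem conjTranspose_incl_mul_incl_apply (D : Partition G d) (α β : D.Label)
    (y : ∀ s, Fin (D.fineDim α s)) (z : ∀ s, Fin (D.fineDim β s)) :
    ((D.incl α).conjTranspose * D.incl β) y z =
      if D.siteIndex α y = D.siteIndex β z then 1 else 0 := by
  rw [Matrix.mul_apply]
  calc ∑ x, (D.incl α).conjTranspose y x * D.incl β x z
      = ∑ x : ∀ j, Fin (d j), ∏ j, (starRingEnd ℂ) (D.basis j (D.siteIndex α y j) (x j)) *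
          D.basis j (D.siteIndex β z j) (x j) := by
        refine Finset.sum_congr rfl fun x _ => ?_
        rw [Finset.prod_mul_distrib, ← map_prod]
        rfl
    _ = ∏ j, ∑ u, (starRingEnd ℂ) (D.basis j (D.siteIndex α y j) u) *
          D.basis j (D.siteIndex β z j) u := by
        rw [Finset.prod_univ_sum, Fintype.piFinset_univ]
    _ = ∏ j, if D.siteIndex α y j = D.siteIndex β z j then 1 else 0 := by
        refine Finset.prod_congr rfl fun j _ => ?_
        have := orthonormal_iff_ite.1 (D.basis j).orthonormal (D.siteIndex α y j)
          (D.siteIndex β z j)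
        simp only [PiLp.inner_apply, RCLike.inner_apply] at this
        rw [← this]
        exact Finset.sum_congr rfl fun _ _ => mul_comm _ _
    _ = _ := by
        rw [Finset.prod_ite_zero]
        simp [funext_iff]

theorem conjTranspose_incl_mul_incl_self (D : Partition G d) (α : D.Label) :
    (D.incl α).conjTranspose * D.incl α = 1 := by
  ext y z
  rw [D.conjTranspose_incl_mul_incl_apply, Matrix.one_apply]
  refine if_congr ⟨fun h => ?_, fun h => by rw [h]⟩ rfl rfl
  exact eq_of_heq (Sigma.mk.inj_iff.1 (D.siteIndex_injective (a₁ := ⟨α, y⟩) (a₂ := ⟨α, z⟩) h)).2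

theorem conjTranspose_incl_mul_incl_of_ne (D : Partition G d) {α β : D.Label} (h : α ≠ β) :
    (D.incl α).conjTranspose * D.incl β = 0 := by
  ext y z
  rw [D.conjTranspose_incl_mul_incl_apply, if_neg]
  · rfl
  · exact fun h' => h (Sigma.mk.inj_iff.1
      (D.siteIndex_injective (a₁ := ⟨α, y⟩) (a₂ := ⟨β, z⟩) h')).1

/-- A label with its fine indices is the same as a choice of one adapted basis vector per particle,
so the sum is the product of the resolutions of the identity on the `ℋ_j`. -/
theorem sum_incl_mul_conjTranspose (D : Partition G d) :
    ∑ α, D.incl α * (D.incl α).conjTranspose = 1 := by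
  ext x x'
  have hb : ∀ j (u v : Fin (d j)), ∑ i, D.basis j i u * (starRingEnd ℂ) (D.basis j i v) =
      if u = v then 1 else 0 := by
    intro j u v
    have := congrArg (fun w : EuclideanSpace ℂ (Fin (d j)) => w u)
      ((D.basis j).sum_repr (EuclideanSpace.single v 1))
    simp only [OrthonormalBasis.repr_apply_apply, EuclideanSpace.inner_single_right] at this
    simpa [mul_comm, Pi.single_apply] using this
  calc (∑ α, D.incl α * (D.incl α).conjTranspose) x x'
      = ∑ z : Σ α : D.Label, ∀ s, Fin (D.fineDim α s), ∏ j,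
          D.basis j (D.siteIndex z.1 z.2 j) (x j) *
            (starRingEnd ℂ) (D.basis j (D.siteIndex z.1 z.2 j) (x' j)) := by
        rw [Matrix.sum_apply, Fintype.sum_sigma]
        refine Finset.sum_congr rfl fun α _ => ?_
        rw [Matrix.mul_apply]
        refine Finset.sum_congr rfl fun y _ => ?_
        rw [Finset.prod_mul_distrib, ← map_prod]
        rfl
    _ = ∑ i : ∀ j, Σ a : Fin (D.numBlocks j),
          Fin (D.freeDim j a) × ∀ k : G.neighborSet j, Fin (D.subDim j a k),
          ∏ j, D.basis j (i j) (x j) * (starRingEnd ℂ) (D.basis j (i j) (x' j)) :=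
        Function.Bijective.sum_comp ⟨D.siteIndex_injective, D.siteIndex_surjective⟩
          (fun i => ∏ j, D.basis j (i j) (x j) * (starRingEnd ℂ) (D.basis j (i j) (x' j)))
    _ = ∏ j, if x j = x' j then 1 else 0 := by
        simp only [← hb]
        rw [Finset.prod_univ_sum, Fintype.piFinset_univ]
    _ = _ := by
        rw [Finset.prod_ite_zero, Matrix.one_apply]
        simp [funext_iff]

theorem incl_injective (D : Partition G d) (α : D.Label) :
    Function.Injective (Matrix.toEuclideanLin (D.incl α)) := by
  intro ξ η h
  have := congrArg (Matrix.toEuclideanLin (D.incl α).conjTranspose) h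
  simpa only [← toEuclideanLin_mul_apply, conjTranspose_incl_mul_incl_self,
    toEuclideanLin_one_apply] using this

theorem block_isOrtho (D : Partition G d) {α β : D.Label} (h : α ≠ β) :
    D.block α ⟂ D.block β := by
  rw [Submodule.isOrtho_iff_inner_eq]
  rintro _ ⟨ξ, rfl⟩ _ ⟨η, rfl⟩
  rw [← LinearMap.adjoint_inner_right, ← Matrix.toEuclideanLin_conjTranspose_eq_adjoint,
    ← toEuclideanLin_mul_apply, D.conjTranspose_incl_mul_incl_of_ne h, map_zero,
    LinearMap.zero_apply, inner_zero_right]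

/-- The operator `h` on the pair of subparticles `j.k`, `k.j` of the edge `e = (j, k)`, tensored
with the identity on all other fine factors of `ℋ^{(α)}`. -/
abbrev pairOp (D : Partition G d) (α : D.Label) (e : Edge G)
    (h : Matrix (D.PairIdx e (α e.1.fst) (α e.1.snd)) (D.PairIdx e (α e.1.fst) (α e.1.snd)) ℂ) :
    Op (D.fineDim α) :=
  twoSite (κ := D.fineDim α) (.inr e.1) (.inr e.1.symm) h

theorem productVector_apply (D : Partition G d) (α : D.Label)
    (v : ∀ j, EuclideanSpace ℂ (Fin (D.freeDim j (α j))))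
    (w : ∀ e : Edge G, EuclideanSpace ℂ (D.PairIdx e (α e.1.fst) (α e.1.snd)))
    (y : ∀ s, Fin (D.fineDim α s)) :
    D.productVector α v w y =
      (∏ j, v j (y (.inl j))) * ∏ e : Edge G, w e (y (.inr e.1), y (.inr e.1.symm)) :=
  rfl

/-- The constituents `j.k` and `k.j` enter only the factor of the edge `e`: other edges use other
darts. -/
theorem pairOp_productVector (D : Partition G d) (α : D.Label) (e : Edge G)
    (h : Matrix (D.PairIdx e (α e.1.fst) (α e.1.snd)) (D.PairIdx e (α e.1.fst) (α e.1.snd)) ℂ)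
    (v : ∀ j, EuclideanSpace ℂ (Fin (D.freeDim j (α j))))
    (w : ∀ e : Edge G, EuclideanSpace ℂ (D.PairIdx e (α e.1.fst) (α e.1.snd))) :
    Matrix.toEuclideanLin (D.pairOp α e h) (D.productVector α v w) =
      D.productVector α v (Function.update w e (Matrix.toEuclideanLin h (w e))) := by
  ext y
  rw [toEuclideanLin_apply_apply]
  refine (sum_twoSite_mul (κ := D.fineDim α) (Edge.inr_ne_inr_symm e) h y _).trans ?_
  let R : ℂ := ∏ e' ∈ Finset.univ.erase e, w e' (y (.inr e'.1), y (.inr e'.1.symm))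
  have h1 : ∀ t : Fin (D.fineDim α (.inr e.1)) × Fin (D.fineDim α (.inr e.1.symm)),
      D.productVector α v w
        (Function.update (Function.update y (.inr e.1) t.1) (.inr e.1.symm) t.2) =
      (∏ j, v j (y (.inl j))) * (w e t * R) := by
    intro t
    rw [D.productVector_apply]
    refine congrArg₂ (· * ·) (Finset.prod_congr rfl fun j _ => ?_) ?_
    · rw [Function.update_of_ne Sum.inl_ne_inr, Function.update_of_ne Sum.inl_ne_inr]
    rw [← Finset.mul_prod_erase _ _ (Finset.mem_univ e)]
    refine congrArg₂ _ ?_ (Finset.prod_congr rfl fun e' he' => ?_)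
    · rw [Function.update_self, Function.update_of_ne (Edge.inr_ne_inr_symm e),
        Function.update_self]
      rfl
    · have hne : e'.1 ≠ e.1 := fun h => (Finset.mem_erase.1 he').1 (Subtype.ext h)
      have hne' : e'.1.symm ≠ e.1.symm := fun h => hne (by
        have := congrArg SimpleGraph.Dart.symm h
        simpa using this)
      rw [Function.update_of_ne (by simpa using Edge.coe_ne_symm e' e),
        Function.update_of_ne (by simpa using hne),
        Function.update_of_ne (by simpa using hne'),
        Function.update_of_ne (by simpa using (Edge.coe_ne_symm e e').symm)]
  have h2 : D.productVector α v (Function.update w e (Matrix.toEuclideanLin h (w e))) y =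
      (∏ j, v j (y (.inl j))) *
        (Matrix.toEuclideanLin h (w e) (y (.inr e.1), y (.inr e.1.symm)) * R) := by
    rw [D.productVector_apply, ← Finset.mul_prod_erase _ _ (Finset.mem_univ e),
      Function.update_self]
    refine congrArg₂ _ rfl (congrArg₂ _ rfl (Finset.prod_congr rfl fun e' he' => ?_))
    rw [Function.update_of_ne (Finset.mem_erase.1 he').1]
  rw [h2, toEuclideanLin_apply_apply, Finset.sum_mul, Finset.mul_sum]
  refine Finset.sum_congr rfl fun t _ => ?_
  rw [h1]
  have comm : ∀ a b c r : ℂ, a * (b * (c * r)) = b * (a * c * r) := fun a b c r => by ring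
  exact comm _ _ _ _

theorem span_productVector (D : Partition G d) (α : D.Label) :
    Submodule.span ℂ {ξ | ∃ v w, ξ = D.productVector α v w} = ⊤ := by
  rw [eq_top_iff, ← (EuclideanSpace.basisFun _ ℂ).toBasis.span_eq, Submodule.span_le]
  rintro _ ⟨y, rfl⟩
  -- Product basis vectors are product vectors, because each dart is an edge or the reversal of one.
  refine Submodule.subset_span ⟨fun j => EuclideanSpace.single (y (.inl j)) 1,
    fun e => EuclideanSpace.single (y (.inr e.1), y (.inr e.1.symm)) 1, ?_⟩
  ext z
  have hz : z = y ↔ (∀ j, z (.inl j) = y (.inl j)) ∧ ∀ e : Edge G,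
      (z (.inr e.1), z (.inr e.1.symm)) = (y (.inr e.1), y (.inr e.1.symm)) := by
    refine ⟨fun h => by simp [h], fun h => funext fun s => ?_⟩
    rcases s with j | a
    · exact h.1 j
    · rcases lt_or_gt_of_ne a.fst_ne_snd with ha | ha
      · exact congrArg Prod.fst (h.2 ⟨a, ha⟩)
      · have := congrArg Prod.snd (h.2 ⟨a.symm, ha⟩)
        exact this
  have e1 : D.productVector α (fun j => EuclideanSpace.single (y (.inl j)) 1)
      (fun e => EuclideanSpace.single (y (.inr e.1), y (.inr e.1.symm)) 1) z =
      (∏ j, if z (.inl j) = y (.inl j) then 1 else 0) * ∏ e : Edge G,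
        if (z (.inr e.1), z (.inr e.1.symm)) = (y (.inr e.1), y (.inr e.1.symm))
          then 1 else 0 := by
    rw [D.productVector_apply]
    exact congrArg₂ (· * ·) (Finset.prod_congr rfl fun j _ => PiLp.single_apply 2 ℂ _ _ _)
      (Finset.prod_congr rfl fun e _ => PiLp.single_apply 2 ℂ _ _ _)
  rw [e1, Finset.prod_ite_zero, Finset.prod_ite_zero]
  simp only [OrthonormalBasis.coe_toBasis, EuclideanSpace.basisFun_apply,
    PiLp.single_apply, hz, Finset.mem_univ, true_imp_iff, Finset.prod_const_one]
  split_ifs <;> simp_all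

/-- The operator `∑ i, g i |b i⟩⟨b i|`, with `b` the adapted basis of `ℋ_j` and `g i` depending only
on the block and on the index of the free factor. -/
def siteDiagonal (D : Partition G d) (j : Fin n) (g : (Σ a, Fin (D.freeDim j a)) → ℂ) :
    Matrix (Fin (d j)) (Fin (d j)) ℂ :=
  Matrix.of fun u v => ∑ i, g ⟨i.1, i.2.1⟩ * D.basis j i u * (starRingEnd ℂ) (D.basis j i v)

theorem sum_siteDiagonal_mul (D : Partition G d) (j : Fin n)
    (g : (Σ a, Fin (D.freeDim j a)) → ℂ) (i : Σ a : Fin (D.numBlocks j),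
      Fin (D.freeDim j a) × ∀ k : G.neighborSet j, Fin (D.subDim j a k)) (u : Fin (d j)) :
    ∑ v, D.siteDiagonal j g u v * D.basis j i v = g ⟨i.1, i.2.1⟩ * D.basis j i u := by
  have hb := fun i' => orthonormal_iff_ite.1 (D.basis j).orthonormal i' i
  simp only [PiLp.inner_apply, RCLike.inner_apply] at hb
  simp only [siteDiagonal, Matrix.of_apply, Finset.sum_mul]
  rw [Finset.sum_comm]
  calc ∑ i', ∑ v, g ⟨i'.1, i'.2.1⟩ * D.basis j i' u *
        (starRingEnd ℂ) (D.basis j i' v) * D.basis j i v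
      = ∑ i', g ⟨i'.1, i'.2.1⟩ * D.basis j i' u * if i' = i then 1 else 0 := by
        refine Finset.sum_congr rfl fun i' _ => ?_
        rw [← hb i', Finset.mul_sum]
        exact Finset.sum_congr rfl fun _ _ => by ring
    _ = _ := by simp

/-! ### Consequences of localization: the common eigenspace and irreducibility. -/

namespace Localizes

variable {D : Partition G d} {h : D.PairOps} {x : Problem G d}

theorem proj_incl_apply (hx : D.Localizes h x) (e : Edge G) (α : D.Label)
    (ξ : Space (D.fineDim α)) :
    Matrix.toEuclideanLin (x.proj e) (Matrix.toEuclideanLin (D.incl α) ξ) =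
      Matrix.toEuclideanLin (D.incl α)
        (Matrix.toEuclideanLin (D.pairOp α e (h e (α e.1.fst) (α e.1.snd))) ξ) := by
  rw [← toEuclideanLin_mul_apply, ← toEuclideanLin_mul_apply]
  exact congrArg (fun M => Matrix.toEuclideanLin M ξ) (hx e α)

theorem pairOp_eq (hx : D.Localizes h x) (e : Edge G) (α : D.Label) :
    D.pairOp α e (h e (α e.1.fst) (α e.1.snd)) =
      (D.incl α).conjTranspose * x.proj e * D.incl α := by
  rw [Matrix.mul_assoc, hx e α, ← Matrix.mul_assoc, D.conjTranspose_incl_mul_incl_self,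
    Matrix.one_mul]

theorem pairOp_conjTranspose (hx : D.Localizes h x) (e : Edge G) (α : D.Label) :
    (D.pairOp α e (h e (α e.1.fst) (α e.1.snd))).conjTranspose =
      D.pairOp α e (h e (α e.1.fst) (α e.1.snd)) := by
  have hs : (x.proj e).conjTranspose = x.proj e := (x.isStarProjection e).isSelfAdjoint
  rw [hx.pairOp_eq, Matrix.conjTranspose_mul, Matrix.conjTranspose_mul,
    Matrix.conjTranspose_conjTranspose, hs, Matrix.mul_assoc]

/-- The adjoint of the localization identity; it shows that block components of vectors in `ℒ` stay
in `ℒ`. -/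
theorem conjTranspose_incl_mul_proj (hx : D.Localizes h x) (e : Edge G) (α : D.Label) :
    (D.incl α).conjTranspose * x.proj e =
      D.pairOp α e (h e (α e.1.fst) (α e.1.snd)) * (D.incl α).conjTranspose := by
  have hs : (x.proj e).conjTranspose = x.proj e := (x.isStarProjection e).isSelfAdjoint
  have := congrArg Matrix.conjTranspose (hx e α)
  rw [Matrix.conjTranspose_mul, Matrix.conjTranspose_mul, hs] at this
  rw [this]
  exact congrArg (· * _) (hx.pairOp_conjTranspose e α)

/-- The projector preserves the block, so its compression is idempotent, and `twoSite_injective`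
carries this down to `h`. -/
theorem isIdempotentElem (hx : D.Localizes h x) (e : Edge G) (α : D.Label) :
    h e (α e.1.fst) (α e.1.snd) * h e (α e.1.fst) (α e.1.snd) = h e (α e.1.fst) (α e.1.snd) := by
  refine twoSite_injective (κ := D.fineDim α) (Edge.inr_ne_inr_symm e) (D.fineDim_pos α) ?_
  refine (twoSite_mul (κ := D.fineDim α) (Edge.inr_ne_inr_symm e) _ _).symm.trans ?_
  change D.pairOp α e (h e _ _) * D.pairOp α e (h e _ _) = D.pairOp α e (h e _ _)
  have hs : x.proj e * x.proj e = x.proj e := (x.isStarProjection e).isIdempotentElem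
  calc D.pairOp α e (h e _ _) * D.pairOp α e (h e _ _)
      = (D.incl α).conjTranspose * x.proj e * (D.incl α * D.pairOp α e (h e _ _)) := by
        conv_lhs => rw [hx.pairOp_eq e α]
        rw [hx.pairOp_eq e α]
        simp only [Matrix.mul_assoc]
    _ = (D.incl α).conjTranspose * (x.proj e * x.proj e) * D.incl α := by
        have := hx e α
        change _ = D.incl α * D.pairOp α e _ at this
        rw [← this]
        simp only [Matrix.mul_assoc]
    _ = D.pairOp α e (h e _ _) := by rw [hs, hx.pairOp_eq]

theorem pairOp_apply_eq_iff (hx : D.Localizes h x) (e : Edge G) (α : D.Label)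
    (ξ : Space (D.fineDim α)) :
    Matrix.toEuclideanLin (x.proj e) (Matrix.toEuclideanLin (D.incl α) ξ) =
        Matrix.toEuclideanLin (D.incl α) ξ ↔
      Matrix.toEuclideanLin (D.pairOp α e (h e (α e.1.fst) (α e.1.snd))) ξ = ξ := by
  rw [hx.proj_incl_apply, (D.incl_injective α).eq_iff]

/-- Product vectors span everything. Applying the operators of the edges one after another leaves
`ξ` unchanged, while in each product vector of its expansion it turns `w e` into `h (w e)`, which is
fixed by idempotence. -/
theorem mem_span_productVector (hx : D.Localizes h x) (α : D.Label) {ξ : Space (D.fineDim α)}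
    (hξ : ∀ e, Matrix.toEuclideanLin (D.pairOp α e (h e (α e.1.fst) (α e.1.snd))) ξ = ξ)
    (S : Finset (Edge G)) :
    ξ ∈ Submodule.span ℂ {η | ∃ v w,
      (∀ e ∈ S, Matrix.toEuclideanLin (h e (α e.1.fst) (α e.1.snd)) (w e) = w e) ∧
        η = D.productVector α v w} := by
  induction S using Finset.induction_on with
  | empty =>
    have : {η | ∃ v w, (∀ e ∈ (∅ : Finset (Edge G)),
        Matrix.toEuclideanLin (h e (α e.1.fst) (α e.1.snd)) (w e) = w e) ∧
        η = D.productVector α v w} = {η | ∃ v w, η = D.productVector α v w} := by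
      simp
    rw [this, D.span_productVector]
    trivial
  | insert e S _ ih =>
    rw [← hξ e]
    have := Submodule.mem_map_of_mem
      (f := Matrix.toEuclideanLin (D.pairOp α e (h e (α e.1.fst) (α e.1.snd)))) ih
    rw [Submodule.map_span] at this
    refine Submodule.span_mono ?_ this
    rintro _ ⟨_, ⟨v, w, hw, rfl⟩, rfl⟩
    refine ⟨v, _, ?_, D.pairOp_productVector α e _ v w⟩
    intro e' he'
    by_cases hee : e' = e
    · subst hee
      rw [Function.update_self, ← toEuclideanLin_mul_apply, hx.isIdempotentElem]
    · rw [Function.update_of_ne hee]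
      exact hw e' (Finset.mem_of_mem_insert_of_ne he' hee)

theorem pairSpace_le (hx : D.Localizes h x) (α : D.Label) :
    D.pairSpace h α ≤ x.eigenspace ⊓ D.block α := by
  refine Submodule.span_le.2 ?_
  rintro _ ⟨v, w, hw, rfl⟩
  refine ⟨fun e => ?_, ⟨_, rfl⟩⟩
  rw [hx.pairOp_apply_eq_iff, D.pairOp_productVector, hw, Function.update_eq_self]

theorem splitsEigenspace (hx : D.Localizes h x) : D.SplitsEigenspace h x := by
  refine ⟨le_antisymm ?_ (iSup_le fun _ => inf_le_left), fun _ _ => D.block_isOrtho,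
    fun α => le_antisymm ?_ (hx.pairSpace_le α)⟩
  · intro ψ hψ
    have h1 := congrArg (fun M => Matrix.toEuclideanLin M ψ) D.sum_incl_mul_conjTranspose
    simp only [toEuclideanLin_one_apply, map_sum, LinearMap.sum_apply,
      toEuclideanLin_mul_apply] at h1
    rw [← h1]
    refine Submodule.sum_mem _ fun α _ => Submodule.mem_iSup_of_mem α ⟨fun e => ?_, ⟨_, rfl⟩⟩
    rw [hx.pairOp_apply_eq_iff, ← toEuclideanLin_mul_apply, ← hx.conjTranspose_incl_mul_proj,
      toEuclideanLin_mul_apply, hψ e]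
  · rintro _ ⟨hψ, ξ, rfl⟩
    have h1 := hx.mem_span_productVector α (ξ := ξ)
      (fun e => (hx.pairOp_apply_eq_iff e α ξ).1 (hψ e)) Finset.univ
    have h2 := Submodule.mem_map_of_mem (f := Matrix.toEuclideanLin (D.incl α)) h1
    rw [Submodule.map_span] at h2
    refine Submodule.span_mono ?_ h2
    rintro _ ⟨_, ⟨v, w, hw, rfl⟩, rfl⟩
    exact ⟨v, w, fun e => hw e (Finset.mem_univ e), rfl⟩

/-- In each block the operator is diagonal in the free index of `j`, which no projector touches;
since the blocks resolve the identity, commuting there suffices. -/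
theorem siteDiagonal_mem_localCommutant (hx : D.Localizes h x) (j : Fin n)
    (g : (Σ a, Fin (D.freeDim j a)) → ℂ) : D.siteDiagonal j g ∈ x.localCommutant j := by
  intro e
  set O := D.siteDiagonal j g
  let Δ : ∀ α : D.Label, Op (D.fineDim α) := fun α =>
    Matrix.diagonal fun y => g ⟨α j, y (.inl j)⟩
  have h2 : ∀ α, oneSite j O * D.incl α = D.incl α * Δ α := by
    intro α
    ext z y
    rw [Matrix.mul_apply, sum_oneSite_mul, Matrix.mul_diagonal]
    have h3 : ∀ u, D.incl α (Function.update z j u) y = D.basis j (D.siteIndex α y j) u *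
        ∏ l ∈ Finset.univ.erase j, D.basis l (D.siteIndex α y l) (z l) := by
      intro u
      rw [D.incl_apply, ← Finset.mul_prod_erase _ _ (Finset.mem_univ j), Function.update_self]
      refine congrArg _ (Finset.prod_congr rfl fun l hl => ?_)
      rw [Function.update_of_ne (Finset.mem_erase.1 hl).1]
    simp only [h3, ← mul_assoc]
    rw [← Finset.sum_mul, D.sum_siteDiagonal_mul, D.incl_apply,
      ← Finset.mul_prod_erase _ _ (Finset.mem_univ j)]
    have comm : ∀ a b c : ℂ, a * b * c = b * c * a := fun a b c => by ring
    exact comm _ _ _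
  have h3 : ∀ α, Δ α * D.pairOp α e (h e _ _) = D.pairOp α e (h e _ _) * Δ α := by
    intro α
    ext y z
    rw [Matrix.diagonal_mul, Matrix.mul_diagonal]
    by_cases hyz : y (.inl j) = z (.inl j)
    · rw [hyz, mul_comm]
    · have : D.pairOp α e (h e (α e.1.fst) (α e.1.snd)) y z = 0 :=
        if_neg fun hl => hyz (hl _ Sum.inl_ne_inr Sum.inl_ne_inr)
      rw [this, mul_zero, zero_mul]
  have h4 : ∀ α, oneSite j O * x.proj e * D.incl α = x.proj e * oneSite j O * D.incl α := by
    intro α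
    have h5 : x.proj e * D.incl α = D.incl α * D.pairOp α e (h e _ _) := hx e α
    rw [Matrix.mul_assoc, h5, ← Matrix.mul_assoc, h2, Matrix.mul_assoc, h3, ← Matrix.mul_assoc,
      ← h5, Matrix.mul_assoc, ← h2, Matrix.mul_assoc]
  rw [← Matrix.mul_one (oneSite j O * x.proj e), ← Matrix.mul_one (x.proj e * oneSite j O),
    ← D.sum_incl_mul_conjTranspose, Finset.mul_sum, Finset.mul_sum]
  exact Finset.sum_congr rfl fun α _ => by rw [← Matrix.mul_assoc, h4, Matrix.mul_assoc]

/-- If the indicator of one pair (block, free index) gives a scalar operator, it takes the same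
value at every pair, so there is no second pair. -/
theorem subsingleton_free (hx : D.Localizes h x) (hirr : x.Irreducible) (j : Fin n) :
    Subsingleton (Σ a, Fin (D.freeDim j a)) := by
  classical
  refine ⟨fun p p' => ?_⟩
  obtain ⟨c, hc⟩ := hirr j _ (hx.siteDiagonal_mem_localCommutant j fun r => if r = p then 1 else 0)
  have h1 : ∀ r : Σ a, Fin (D.freeDim j a), (if r = p then (1 : ℂ) else 0) = c := by
    intro r
    let i₀ : Σ a : Fin (D.numBlocks j),
        Fin (D.freeDim j a) × ∀ k : G.neighborSet j, Fin (D.subDim j a k) :=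
      ⟨r.1, r.2, fun k => ⟨0, D.subDim_pos _ _ _⟩⟩
    obtain ⟨u, hu⟩ : ∃ u, D.basis j i₀ u ≠ 0 := by
      by_contra! h0
      exact (D.basis j).orthonormal.ne_zero i₀ (PiLp.ext h0)
    have h2 := D.sum_siteDiagonal_mul j (fun r => if r = p then 1 else 0) i₀ u
    rw [hc] at h2
    simp only [Matrix.smul_apply, Matrix.one_apply, smul_eq_mul, mul_ite, mul_one, mul_zero,
      ite_mul, zero_mul, Finset.sum_ite_eq, Finset.mem_univ, if_true] at h2
    refine (mul_right_cancel₀ hu ?_).symm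
    simpa using h2
  have h2 := (h1 p').trans (h1 p).symm
  by_contra hne
  simp [Ne.symm hne] at h2

end Localizes

theorem numBlocks_pos (D : Partition G d) {j : Fin n} (hj : 0 < d j) : 0 < D.numBlocks j := by
  by_contra h0
  have : IsEmpty (Fin (D.numBlocks j)) := by
    rw [Nat.eq_zero_of_not_pos h0]
    infer_instance
  have h1 := Module.finrank_eq_card_basis (D.basis j).toBasis
  rw [finrank_euclideanSpace_fin, Fintype.card_eq_zero] at h1
  exact hj.ne' h1

theorem Localizes.numBlocks_eq_one {D : Partition G d} {h : D.PairOps} {x : Problem G d}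
    (hx : D.Localizes h x) (hirr : x.Irreducible) {j : Fin n} (hj : 0 < d j) :
    D.numBlocks j = 1 := by
  have := hx.subsingleton_free hirr j
  refine le_antisymm (Fin.subsingleton_iff_le_one.1 ⟨fun a b => ?_⟩) (D.numBlocks_pos hj)
  exact congrArg Sigma.fst (Subsingleton.elim
    (⟨a, ⟨0, D.freeDim_pos j a⟩⟩ : Σ a, Fin (D.freeDim j a)) ⟨b, ⟨0, D.freeDim_pos j b⟩⟩)

theorem Localizes.freeDim_eq_one {D : Partition G d} {h : D.PairOps} {x : Problem G d}
    (hx : D.Localizes h x) (hirr : x.Irreducible) (j : Fin n) (a : Fin (D.numBlocks j)) :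
    D.freeDim j a = 1 := by
  have := hx.subsingleton_free hirr j
  refine le_antisymm (Fin.subsingleton_iff_le_one.1 ⟨fun f f' => ?_⟩) (D.freeDim_pos j a)
  exact eq_of_heq (Sigma.mk.inj_iff.1 (Subsingleton.elim
    (⟨a, f⟩ : Σ a, Fin (D.freeDim j a)) ⟨a, f'⟩)).2

theorem productVector_ne_zero (D : Partition G d) (α : D.Label)
    {v : ∀ j, EuclideanSpace ℂ (Fin (D.freeDim j (α j)))}
    {w : ∀ e : Edge G, EuclideanSpace ℂ (D.PairIdx e (α e.1.fst) (α e.1.snd))}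
    (hv : ∀ j, v j ≠ 0) (hw : ∀ e, w e ≠ 0) : D.productVector α v w ≠ 0 := by
  have hv' : ∀ j, ∃ i, v j i ≠ 0 := fun j => by
    by_contra! h0
    exact hv j (PiLp.ext h0)
  have hw' : ∀ e, ∃ i, w e i ≠ 0 := fun e => by
    by_contra! h0
    exact hw e (PiLp.ext h0)
  choose f hf using hv'
  choose u hu using hw'
  -- A configuration where every factor is nonzero: an increasing dart takes the first entry of its
  -- edge's index, a decreasing one the second entry of the reversed edge's.
  let y : ∀ s, Fin (D.fineDim α s) := fun s => match s with
    | .inl j => f j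
    | .inr a => if ha : a.fst < a.snd then (u ⟨a, ha⟩).1 else
        (u ⟨a.symm, lt_of_le_of_ne (not_lt.1 ha) a.snd_ne_fst⟩).2
  have hy : ∀ e : Edge G, (y (.inr e.1), y (.inr e.1.symm)) = u e := by
    intro e
    refine Prod.ext ?_ ?_
    · exact dif_pos e.2
    · exact dif_neg (lt_asymm e.2)
  intro h0
  have h1 : D.productVector α v w y = 0 := by rw [h0]; rfl
  rw [D.productVector_apply] at h1
  refine mul_ne_zero (Finset.prod_ne_zero_iff.2 fun j _ => hf j)
    (Finset.prod_ne_zero_iff.2 fun e _ => ?_) h1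
  have := hu e
  rw [← hy e] at this
  exact this

/-- With a single block, `h e = 0` would force the projector to vanish. Each `h e` is thus a nonzero
idempotent with a nonzero fixed vector, and distinct edges impose no joint condition. -/
theorem Localizes.eigenspace_ne_bot {D : Partition G d} {h : D.PairOps} {x : Problem G d}
    (hx : D.Localizes h x) (hD : ∀ j, D.numBlocks j = 1) (h0 : ∀ e, x.proj e ≠ 0) :
    x.eigenspace ≠ ⊥ := by
  let α : D.Label := fun j => ⟨0, by rw [hD j]; exact one_pos⟩
  have hα : ∀ β : D.Label, β = α := fun β => funext fun j => by
    have : Subsingleton (Fin (D.numBlocks j)) := Fin.subsingleton_iff_le_one.2 (hD j).le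
    exact Subsingleton.elim _ _
  have hne : ∀ e : Edge G, h e (α e.1.fst) (α e.1.snd) ≠ 0 := by
    intro e he
    refine h0 e ?_
    have h1 : x.proj e * D.incl α = 0 := by
      have h2 : D.pairOp α e (h e (α e.1.fst) (α e.1.snd)) = 0 := by
        ext y z
        rw [he]
        exact ite_self _
      have h3 : x.proj e * D.incl α = D.incl α * D.pairOp α e (h e _ _) := hx e α
      rw [h3, h2, Matrix.mul_zero]
    rw [← Matrix.mul_one (x.proj e), ← D.sum_incl_mul_conjTranspose, Finset.mul_sum]
    refine Finset.sum_eq_zero fun β _ => ?_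
    rw [hα β, ← Matrix.mul_assoc, h1, Matrix.zero_mul]
  have hw : ∀ e : Edge G, ∃ w, w ≠ 0 ∧
      Matrix.toEuclideanLin (h e (α e.1.fst) (α e.1.snd)) w = w := by
    intro e
    have h1 : Matrix.toEuclideanLin (h e (α e.1.fst) (α e.1.snd)) ≠ 0 := fun h1 =>
      hne e (Matrix.toEuclideanLin.map_eq_zero_iff.1 h1)
    obtain ⟨w, hw⟩ : ∃ w, Matrix.toEuclideanLin (h e (α e.1.fst) (α e.1.snd)) w ≠ 0 := by
      by_contra! h2
      exact h1 (LinearMap.ext h2)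
    exact ⟨_, hw, by rw [← toEuclideanLin_mul_apply, hx.isIdempotentElem]⟩
  choose w hw hfix using hw
  let v : ∀ j, EuclideanSpace ℂ (Fin (D.freeDim j (α j))) := fun j =>
    EuclideanSpace.single ⟨0, D.freeDim_pos j _⟩ 1
  have hv : ∀ j, v j ≠ 0 := fun j => by simp [v]
  have hmem := hx.pairSpace_le α (Submodule.subset_span ⟨v, w, hfix, rfl⟩)
  intro hbot
  have h1 := (Submodule.mem_bot ℂ).1 (hbot.le hmem.1)
  exact D.productVector_ne_zero α hv hw (D.incl_injective α (h1.trans (map_zero _).symm))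

end Partition

/-! ### Existence of a localizing partition, and the theorem. -/

theorem Problem.exists_partition (x : Problem G d) (hd : ∀ j, 0 < d j) :
    ∃ (D : Partition G d) (h : D.PairOps), D.Localizes h x := by
  let S : ∀ j, G.neighborSet j → Set (Module.End ℂ (EuclideanSpace ℂ (Fin (d j)))) := fun j k =>
    {T | ∃ e : Edge G, e.1.edge = s(j, (k : Fin n)) ∧ ∃ y z,
      T = Matrix.toEuclideanLin (slice j (x.proj e) y z)}
  have hloc : ∀ (e : Edge G) (j k : Fin n), e.1.edge = s(j, k) → ∃ H,
      x.proj e = twoSite j k H := by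
    rintro e j k he
    obtain ⟨H, hH⟩ := x.twoLocal e
    have he' : s(e.1.fst, e.1.snd) = s(j, k) := he
    rw [Sym2.eq_iff] at he'
    rcases he' with ⟨rfl, rfl⟩ | ⟨rfl, rfl⟩
    · exact ⟨H, hH⟩
    · exact ⟨_, hH.trans (twoSite_swap _ _ _)⟩
  have hS : ∀ j, HasTensorBasis (S j) := by
    intro j
    refine exists_tensorBasis _ (hd j) (S j) ?_ ?_
    · rintro k _ ⟨e, he, y, z, rfl⟩
      -- Taking the adjoint of a slice of a self-adjoint operator exchanges the two background
      -- configurations.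
      refine ⟨e, he, z, y, ?_⟩
      have hs : (x.proj e).conjTranspose = x.proj e := (x.isStarProjection e).isSelfAdjoint
      rw [← Matrix.toEuclideanLin_conjTranspose_eq_adjoint]
      conv_rhs => rw [← hs]
      rfl
    · rintro k l hkl _ ⟨e, he, y, z, rfl⟩ _ ⟨e', he', y', z', rfl⟩
      obtain ⟨H, hH⟩ := hloc e j k he
      obtain ⟨H', hH'⟩ := hloc e' j l he'
      have hc := x.commute e e'
      rw [hH, hH'] at hc
      have h1 := slice_mul_slice_comm (G.ne_of_adj k.2) (G.ne_of_adj l.2)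
        (fun h => hkl (Subtype.ext h)) hc y z y' z'
      rw [← hH, ← hH'] at h1
      refine LinearMap.ext fun ξ => ?_
      rw [Module.End.mul_apply, Module.End.mul_apply, ← toEuclideanLin_mul_apply, h1,
        toEuclideanLin_mul_apply]
  choose r p q b hp hq hb using hS
  let D : Partition G d := ⟨r, p, q, hp, hq, b⟩
  obtain ⟨h, hx⟩ := exists_localizes D x hd fun j k e he y z => hb j k _ ⟨e, he, y, z, rfl⟩
  exact ⟨D, h, hx⟩

end CES

end

theorem mainTheorem2 {n : ℕ} (G : SimpleGraph (Fin n)) [DecidableRel G.Adj] (d : Fin n → ℕ)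
    (hd : ∀ j, 0 < d j) (x : CES.Problem G d) :
    (∃ (D : CES.Partition G d) (h : D.PairOps), D.Localizes h x ∧ D.SplitsEigenspace h x) ∧
    (x.Irreducible →
      (∃ (D : CES.Partition G d) (h : D.PairOps),
        (∀ j, D.numBlocks j = 1) ∧ (∀ j a, D.freeDim j a = 1) ∧
        D.Localizes h x ∧ D.SplitsEigenspace h x) ∧
      ((∀ e, x.proj e ≠ 0) → x.eigenspace ≠ ⊥)) := by
  obtain ⟨D, h, hx⟩ := x.exists_partition hd
  refine ⟨⟨D, h, hx, hx.splitsEigenspace⟩, fun hirr => ?_⟩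
  have h1 : ∀ j, D.numBlocks j = 1 := fun j => hx.numBlocks_eq_one hirr (hd j)
  exact ⟨⟨D, h, h1, hx.freeDim_eq_one hirr, hx, hx.splitsEigenspace⟩, hx.eigenspace_ne_bot h1⟩
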